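/- For $d_{\mathrm{in}},d_{\mathrm{out}}\ge 1$, a *channel* is a completely positive, trace-preserving linear map $\mathbb{C}^{d_{\mathrm{in}}\times d_{\mathrm{in}}}\to\mathbb{C}^{d_{\mathrm{out}}\times d_{\mathrm{out}}}$, and the diamond norm of a linear map $\mathcal{L}$ between these spaces is $$\|\mathcal{L}\|_\diamond=\max_{\|X\|_1\le 1}\|(\mathcal{L}\otimes\mathcal{I}_{d_{\mathrm{in}}})X\|_1,\qquad X\in\mathbb{C}^{d_{\mathrm{in}}\times d_{\mathrm{in}}}\otimes\mathbb{C}^{d_{\mathrm{in}}\times d_{\mathrm{in}}},$$ where $\|\cdot\|_1$ is the trace norm (sum of singular values). A *deterministic ancilla-free, non-adaptive tester* making $n$ queries to a channel $\mathcal{M}$ consists of pure states $\psi_1,\dots,\psi_n$ in $\mathbb{C}^{d_{\mathrm{in}}\times d_{\mathrm{in}}}$, POVMs $P^{(1)},\dots,P^{(n)}$ on $\mathbb{C}^{d_{\mathrm{out}}\times d_{\mathrm{out}}}$ where $P^{(j)}$ has $m_j$ elements, and a function $f:[m_1]\times\dots\times[m_n]\to\{\text{Accept},\text{Reject}\}$.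 It measures each $\mathcal{M}(\psi_j)$ with $P^{(j)}$ separately, obtaining outcomes $x=(x_1,\dots,x_n)$, and outputs $f(x)$. A *tester* is a random variable taking values in the deterministic testers making $n$ queries. **Theorem.** There are universal constants $C>0$ and $k\in\mathbb{N}$ such that the following holds for all integers $d_{\mathrm{in}},d_{\mathrm{out}}\ge 1$, every fixed channel $\mathcal{N}:\mathbb{C}^{d_{\mathrm{in}}\times d_{\mathrm{in}}}\to\mathbb{C}^{d_{\mathrm{out}}\times d_{\mathrm{out}}}$ and every $\varepsilon>0$. Put $q=d_{\mathrm{in}}^2d_{\mathrm{out}}^{3/2}/\varepsilon^2$. There is an ancilla-free, non-adaptive tester making $$n\le C\,q\,\bigl(\log_2(2+q)\bigr)^k=\tilde O\!\left(d_{\mathrm{in}}^2d_{\mathrm{out}}^{3/2}/\varepsilon^2\right)$$ queries to an unknown channel $\mathcal{M}:\mathbb{C}^{d_{\mathrm{in}}\times d_{\mathrm{in}}}\to\mathbb{C}^{d_{\mathrm{out}}\times d_{\mathrm{out}}}$ that accepts with probability at least $2/3$ if $\mathcal{M}=\mathcal{N}$, and rejects with probability at least $2/3$ if $\|\mathcal{M}-\mathcal{N}\|_\diamond\ge\varepsilon$.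 -/

import Mathlib

open scoped BigOperators Matrix ComplexOrder

noncomputable section

/-- A superoperator: a linear map from `dIn × dIn` complex matrices to `dOut × dOut` ones. -/
abbrev Superoperator (dIn dOut : ℕ) : Type :=
  Matrix (Fin dIn) (Fin dIn) ℂ →ₗ[ℂ] Matrix (Fin dOut) (Fin dOut) ℂ

/-- The trivial extension `L ⊗ I_k`, where matrices on `ℂ^d ⊗ ℂ^k` are indexed by `Fin d × Fin k`:
it applies `L` to each of the `k × k` blocks, i.e. it maps `∑ X_ij ⊗ |i⟩⟨j|` to
`∑ L(X_ij) ⊗ |i⟩⟨j|`. -/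
def Superoperator.tensorId {dIn dOut : ℕ} (L : Superoperator dIn dOut) (k : ℕ) :
    Matrix (Fin dIn × Fin k) (Fin dIn × Fin k) ℂ →ₗ[ℂ]
      Matrix (Fin dOut × Fin k) (Fin dOut × Fin k) ℂ where
  toFun X := Matrix.of fun p q =>
    L (Matrix.of fun a b => X (a, p.2) (b, q.2)) p.1 q.1
  map_add' X Y := by
    ext p q
    exact congrFun (congrFun (L.map_add (Matrix.of fun a b => X (a, p.2) (b, q.2))
      (Matrix.of fun a b => Y (a, p.2) (b, q.2))) p.1) q.1
  map_smul' c X := by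
    ext p q
    exact congrFun (congrFun (L.map_smul c (Matrix.of fun a b => X (a, p.2) (b, q.2))) p.1) q.1

/-- A quantum channel: a completely positive and trace-preserving superoperator. -/
structure IsChannel {dIn dOut : ℕ} (L : Superoperator dIn dOut) : Prop where
  completelyPositive : ∀ (k : ℕ) (X : Matrix (Fin dIn × Fin k) (Fin dIn × Fin k) ℂ),
    X.PosSemidef → (L.tensorId k X).PosSemidef
  tracePreserving : ∀ X : Matrix (Fin dIn) (Fin dIn) ℂ, (L X).trace = X.trace

/-- The trace norm of a square complex matrix: the sum of its singular values. -/
def traceNorm {ι : Type} [Fintype ι] [DecidableEq ι] (A : Matrix ι ι ℂ) : ℝ :=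
  ∑ i ∈ Finset.range (Fintype.card ι), (Matrix.toEuclideanLin A).singularValues i

/-- The diamond norm of a superoperator: the largest trace norm of `(L ⊗ I_{dIn}) X` over all `X`
of trace norm at most one. -/
def diamondNorm {dIn dOut : ℕ} (L : Superoperator dIn dOut) : ℝ :=
  sSup ((fun X : Matrix (Fin dIn × Fin dIn) (Fin dIn × Fin dIn) ℂ =>
    traceNorm (L.tensorId dIn X)) '' {X | traceNorm X ≤ 1})

/-- A pure state, as a rank-one density matrix `|v⟩⟨v|` with `v` a unit vector. -/
def IsPureState {d : ℕ} (ρ : Matrix (Fin d) (Fin d) ℂ) : Prop :=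
  ∃ v : EuclideanSpace ℂ (Fin d), ‖v‖ = 1 ∧ ρ = Matrix.vecMulVec v.ofLp (star v.ofLp)

/-- A positive operator-valued measure with `m` outcomes. -/
structure IsPOVM {d m : ℕ} (P : Fin m → Matrix (Fin d) (Fin d) ℂ) : Prop where
  posSemidef : ∀ i, (P i).PosSemidef
  sum_eq_one : ∑ i, P i = 1

/-- A deterministic ancilla-free, non-adaptive channel tester making `n` queries. All input states
and all measurements are fixed in advance, the `j`-th measurement is on the output of the `j`-th
query alone, and only the classical outcomes are processed jointly. The decision `true` means
"accept" and `false` means "reject". -/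
structure DeterministicTester (dIn dOut n : ℕ) where
  input : Fin n → Matrix (Fin dIn) (Fin dIn) ℂ
  input_pure : ∀ j, IsPureState (input j)
  numOutcomes : Fin n → ℕ
  povm : ∀ j, Fin (numOutcomes j) → Matrix (Fin dOut) (Fin dOut) ℂ
  povm_isPOVM : ∀ j, IsPOVM (povm j)
  decision : (∀ j, Fin (numOutcomes j)) → Bool

/-- The probability that the deterministic tester `T` outputs `b` when querying `M`: the `n`
measurements are independent, and outcome `i` of the `j`-th one has probability
`tr (P^(j)_i M(ψ_j))`. -/
def DeterministicTester.outputProb {dIn dOut n : ℕ} (T : DeterministicTester dIn dOut n)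
    (M : Superoperator dIn dOut) (b : Bool) : ℝ :=
  ∑ x with T.decision x = b, ∏ j, (T.povm j (x j) * M (T.input j)).trace.re

/-- A (randomized) ancilla-free, non-adaptive channel tester making `n` queries: a random variable
whose values are deterministic testers, on some probability space. -/
structure ChannelTester (dIn dOut n : ℕ) where
  Ω : Type
  [measurableSpace : MeasurableSpace Ω]
  μ : MeasureTheory.Measure Ω
  [isProbabilityMeasure : MeasureTheory.IsProbabilityMeasure μ]
  tester : Ω → DeterministicTester dIn dOut n
  measurable_outputProb : ∀ M : Superoperator dIn dOut, IsChannel M → ∀ b : Bool,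
    Measurable fun ω => (tester ω).outputProb M b

/-- The probability that the tester `T` outputs `b` when querying `M`, over both the choice of the
deterministic tester and the measurement outcomes. -/
def ChannelTester.outputProb {dIn dOut n : ℕ} (T : ChannelTester dIn dOut n)
    (M : Superoperator dIn dOut) (b : Bool) : ℝ :=
  letI := T.measurableSpace
  ∫ ω, (T.tester ω).outputProb M b ∂T.μ

/-- The probability that the tester accepts. -/
def ChannelTester.acceptProb {dIn dOut n : ℕ} (T : ChannelTester dIn dOut n)
    (M : Superoperator dIn dOut) : ℝ := T.outputProb M true

/-- The probability that the tester rejects. -/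
def ChannelTester.rejectProb {dIn dOut n : ℕ} (T : ChannelTester dIn dOut n)
    (M : Superoperator dIn dOut) : ℝ := T.outputProb M false

/-- The tester `T` decides, with success probability at least `2/3`, whether a channel `M` equals
`N` or is at diamond distance at least `ε` from `N`. -/
def ChannelTester.TestsIdentity {dIn dOut n : ℕ} (T : ChannelTester dIn dOut n)
    (N : Superoperator dIn dOut) (ε : ℝ) : Prop :=
  ∀ M : Superoperator dIn dOut, IsChannel M →
    (M = N → 2 / 3 ≤ T.acceptProb M) ∧
    (ε ≤ diamondNorm (M - N) → 2 / 3 ≤ T.rejectProb M)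

end

/-!
Write `L = M - N` and let `‖J‖` be the Hilbert–Schmidt norm of the Choi matrix `J` of `L`. Since
`(L ⊗ I)|x⟩⟨y|` is `J` multiplied on both sides by matrices acting on the input factor only,
`‖L‖_⋄ ≤ √dOut ‖J‖` (`diamondNorm_le`).

One query uses a random setting. The input is a vector of random phases in the standard basis or in
the Fourier basis, and the measurement is in the columns of `D F`, with `D` a diagonal matrix of
random phases and `F` the Fourier matrix, again in the standard or the Fourier basis. A quadratic
form at a random phase vector sees the trace and the off-diagonal part of its matrix, and what is
diagonal in one of two unbiased bases is off-diagonal or scalar in the other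
(`IsFlatUnitary.hsNormSq_le`). Hence each of the `dOut` differences of outcome probabilities has
mean square at least `‖J‖² / (dIn dOut)²` when summed over the four pairs of bases
(`choiNormSq_le_sum_expect`).

These differences are polynomials of degree at most `4` in independent signs. By Bonami's
hypercontractive inequality (`expect_pow_four_le_on`) their first and second moments are comparable,
and the Paley–Zygmund argument shows that with constant probability the two outcome distributions
are at `ℓ¹` distance at least `w`, of the order of `ε / (dIn √dOut)`
(`expect_indicator_outcome_far`).

For a fixed setting the known distribution `q` of `N` is compared with that of `M` by a classical
identity test with `O(√dOut / w²)` samples. Its statistic is the inner product of the deviations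
from `q` of the counts of two batches of samples, with weights `1 / (1 + dOut q_j)`. The weights cost
a factor `2 dOut` against the squared `ℓ¹` distance and make `q` behave like the uniform distribution
in the variance bound, so that Chebyshev's inequality suffices (`iidExp_le_crossStat_null`,
`iidExp_crossStat_far`).

A constant number `K` of independent settings, accepting if all the tests accept, amplifies the
constant detection probability. The number of queries is `O(√dOut / w²) = O(dIn² dOut^{3/2} / ε²)`,
with no logarithmic factor, so the exponent `k = 0` is used. If no channel is `ε`-far from `N`, no
query is needed; otherwise `w ≤ 2`, and rounding up the number of queries is harmless.
-/

/-! ### Independent samples from a finite distribution -/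

section IID

variable {σ α : Type} [Fintype σ] [DecidableEq σ] [Fintype α]

/-- The expectation of `F` over a family of samples, indexed by `σ`, drawn independently from the
distribution `p`. -/
noncomputable def iidExp (p : α → ℝ) (F : (σ → α) → ℝ) : ℝ := ∑ x : σ → α, (∏ s, p (x s)) * F x

lemma iidExp_add (p : α → ℝ) (F G : (σ → α) → ℝ) :
    iidExp p (fun x => F x + G x) = iidExp p F + iidExp p G := by
  simp [iidExp, mul_add, Finset.sum_add_distrib]

lemma iidExp_sum {κ : Type} (p : α → ℝ) (S : Finset κ) (F : κ → (σ → α) → ℝ) :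
    iidExp p (fun x => ∑ k ∈ S, F k x) = ∑ k ∈ S, iidExp p (F k) := by
  simp only [iidExp, Finset.mul_sum]
  exact Finset.sum_comm

lemma iidExp_mul_left (p : α → ℝ) (c : ℝ) (F : (σ → α) → ℝ) :
    iidExp p (fun x => c * F x) = c * iidExp p F := by
  simp only [iidExp, Finset.mul_sum]
  exact Finset.sum_congr rfl fun x _ => by ring

lemma iidExp_mul_right (p : α → ℝ) (c : ℝ) (F : (σ → α) → ℝ) :
    iidExp p (fun x => F x * c) = iidExp p F * c := by
  simp only [iidExp, Finset.sum_mul]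
  exact Finset.sum_congr rfl fun x _ => by ring

lemma iidExp_mono {p : α → ℝ} (hp : ∀ a, 0 ≤ p a) {F G : (σ → α) → ℝ} (h : ∀ x, F x ≤ G x) :
    iidExp p F ≤ iidExp p G :=
  Finset.sum_le_sum fun x _ =>
    mul_le_mul_of_nonneg_left (h x) (Finset.prod_nonneg fun s _ => hp (x s))

lemma iidExp_prod (p : α → ℝ) (G : σ → α → ℝ) :
    iidExp p (fun x => ∏ s, G s (x s)) = ∏ s, ∑ a, p a * G s a := by
  rw [Finset.prod_univ_sum]
  simp only [Fintype.piFinset_univ, Finset.prod_mul_distrib, iidExp]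

lemma iidExp_const {p : α → ℝ} (hp : ∑ a, p a = 1) (c : ℝ) :
    iidExp (σ := σ) p (fun _ => c) = c := by
  have h := iidExp_prod (σ := σ) p (fun _ _ => 1)
  have h2 := iidExp_mul_right (σ := σ) p c (fun _ => 1)
  simp only [Finset.prod_const_one, mul_one, hp, one_mul] at h h2
  rw [h2, h, one_mul]

lemma iidExp_apply {p : α → ℝ} (hp : ∑ a, p a = 1) (g : α → ℝ) (s : σ) :
    iidExp p (fun x => g (x s)) = ∑ a, p a * g a := by
  have h := iidExp_prod p (fun r a => if r = s then g a else 1)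
  have h1 : ∀ x : σ → α, (∏ r, if r = s then g (x r) else 1) = g (x s) := fun x => by simp
  simp only [h1] at h
  rw [h, Finset.prod_eq_single s]
  · simp
  · intro b _ hb
    simp [hb, hp]
  · simp

lemma iidExp_apply_mul_apply {p : α → ℝ} (hp : ∑ a, p a = 1) (g h : α → ℝ) {s t : σ}
    (hst : s ≠ t) :
    iidExp p (fun x => g (x s) * h (x t)) = (∑ a, p a * g a) * ∑ a, p a * h a := by
  have key := iidExp_prod p
    (fun r a => (if r = s then g a else 1) * (if r = t then h a else 1))
  have h1 : ∀ x : σ → α, (∏ r, (if r = s then g (x r) else 1) * (if r = t then h (x r) else 1))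
      = g (x s) * h (x t) := fun x => by
    rw [Finset.prod_mul_distrib]; simp
  simp only [h1] at key
  rw [key, Finset.prod_eq_mul s t hst]
  · simp [hst, hst.symm]
  · intro c _ hc
    simp [hc.1, hc.2, hp]
  · simp
  · simp

lemma iidExp_sum_mul_sum {p : α → ℝ} (hp : ∑ a, p a = 1) (g h : α → ℝ) :
    iidExp p (fun x : σ → α => (∑ s, g (x s)) * ∑ t, h (x t)) =
      Fintype.card σ * ((∑ a, p a * (g a * h a)) - (∑ a, p a * g a) * ∑ a, p a * h a)
        + (Fintype.card σ : ℝ) ^ 2 * ((∑ a, p a * g a) * ∑ a, p a * h a) := by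
  conv_lhs => simp only [Finset.sum_mul_sum]
  rw [iidExp_sum]
  simp only [iidExp_sum]
  have h1 : ∀ s t : σ, iidExp p (fun x => g (x s) * h (x t)) =
      (if s = t then (∑ a, p a * (g a * h a)) - (∑ a, p a * g a) * ∑ a, p a * h a else 0)
        + (∑ a, p a * g a) * ∑ a, p a * h a := by
    intro s t
    by_cases hst : s = t
    · subst hst
      rw [iidExp_apply hp (fun a => g a * h a)]
      simp
    · rw [iidExp_apply_mul_apply hp g h hst]
      simp [hst]
  simp only [h1, Finset.sum_add_distrib, Finset.sum_ite_eq, Finset.mem_univ, if_true,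
    Finset.sum_const, Finset.card_univ, nsmul_eq_mul]
  generalize ∑ a, p a * g a = u
  generalize ∑ a, p a * h a = v
  ring

lemma iidExp_sum_type (p : α → ℝ) (F : (σ → α) → (σ → α) → ℝ) :
    iidExp p (fun z : σ ⊕ σ → α => F (z ∘ Sum.inl) (z ∘ Sum.inr)) =
      iidExp p (fun x => iidExp p (fun y => F x y)) := by
  have : ∀ G : (σ → α) × (σ → α) → ℝ,
      ∑ z, G z = ∑ x, ∑ y, G (x, y) := fun G => Fintype.sum_prod_type G
  simp only [iidExp, Finset.mul_sum]
  rw [← Equiv.sum_comp (Equiv.sumArrowEquivProdArrow σ σ α).symm, this]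
  refine Finset.sum_congr rfl fun x _ => Finset.sum_congr rfl fun y _ => ?_
  simp only [Fintype.prod_sum_type]
  rw [← mul_assoc]
  rfl

end IID

/-! ### Testing identity of finite distributions -/

section IdentityTest

variable {σ α : Type} [Fintype σ] [DecidableEq σ] [Fintype α]

/-- The weight `1 / (1 + d q_j)` of outcome `j`, which damps the outcomes that are more likely
than under the uniform distribution. -/
noncomputable def dampWeight (q : α → ℝ) (j : α) : ℝ := 1 / (1 + Fintype.card α * q j)

lemma dampWeight_pos {q : α → ℝ} (hq : ∀ a, 0 ≤ q a) (j : α) : 0 < dampWeight q j := by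
  have := hq j
  unfold dampWeight
  positivity

lemma dampWeight_le_one {q : α → ℝ} (hq : ∀ a, 0 ≤ q a) (j : α) : dampWeight q j ≤ 1 := by
  have := hq j
  unfold dampWeight
  rw [div_le_one (by positivity)]
  have : 0 ≤ (Fintype.card α : ℝ) * q j := by positivity
  linarith

lemma dampWeight_mul_le {q : α → ℝ} (hq : ∀ a, 0 ≤ q a) (j : α) :
    dampWeight q j * q j ≤ 1 / Fintype.card α := by
  have h := hq j
  have hd : 0 < (Fintype.card α : ℝ) := by
    exact_mod_cast Fintype.card_pos_iff.mpr ⟨j⟩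
  unfold dampWeight
  rw [div_mul_eq_mul_div, div_le_div_iff₀ (by positivity) hd]
  nlinarith

/-- The squared distance of `p` and `q` with the damping weights, the normalized mean of the
statistic. -/
noncomputable def dampDist (p q : α → ℝ) : ℝ := ∑ j, dampWeight q j * (p j - q j) ^ 2

/-- The damping weights cost only a factor `2d` against the `ℓ¹` distance, because
`∑ (1 + d q_j) = 2d`. -/
lemma sq_sum_abs_le_dampDist {p q : α → ℝ} (hq : ∀ a, 0 ≤ q a) (hq1 : ∑ a, q a = 1) :
    (∑ j, |p j - q j|) ^ 2 ≤ 2 * Fintype.card α * dampDist p q := by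
  have h := Finset.sum_sq_le_sum_mul_sum_of_sq_le_mul Finset.univ
    (r := fun j => |p j - q j|) (f := fun j => 1 + Fintype.card α * q j)
    (g := fun j => dampWeight q j * (p j - q j) ^ 2)
    (fun j _ => by have := hq j; positivity)
    (fun j _ => mul_nonneg (dampWeight_pos hq j).le (sq_nonneg _))
    (fun j _ => by
      have := hq j
      have h2 : (1 : ℝ) + Fintype.card α * q j ≠ 0 := by positivity
      rw [sq_abs, dampWeight, ← mul_assoc, mul_one_div_cancel h2, one_mul])
  refine h.trans (le_of_eq ?_)
  rw [Finset.sum_add_distrib, ← Finset.mul_sum, hq1, dampDist, Finset.sum_const, Finset.card_univ,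
    nsmul_eq_mul]
  ring

lemma sum_dampWeight_mul_sq_le {q : α → ℝ} (hq : ∀ a, 0 ≤ q a) (hq1 : ∑ a, q a = 1) :
    ∑ j, (dampWeight q j * q j) ^ 2 ≤ 1 / Fintype.card α := by
  calc ∑ j, (dampWeight q j * q j) ^ 2 ≤ ∑ j, 1 / Fintype.card α * q j := by
        refine Finset.sum_le_sum fun j _ => ?_
        rw [sq]
        exact mul_le_mul (dampWeight_mul_le hq j)
          (mul_le_of_le_one_left (hq j) (dampWeight_le_one hq j))
          (mul_nonneg (dampWeight_pos hq j).le (hq j)) (by positivity)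
    _ = _ := by rw [← Finset.mul_sum, hq1, mul_one]

variable [DecidableEq α]

/-- The statistic of the identity test for `q`: the weighted inner product of the deviations from
`q` of the empirical counts of two batches of samples. -/
noncomputable def crossStat (q : α → ℝ) (z : σ ⊕ σ → α) : ℝ :=
  ∑ j, dampWeight q j * ((∑ s, ((if z (.inl s) = j then 1 else 0) - q j)) *
    ∑ t, ((if z (.inr t) = j then 1 else 0) - q j))

lemma sum_mul_indicator_sub {p : α → ℝ} (hp : ∑ a, p a = 1) (q : α → ℝ) (j : α) :
    ∑ a, p a * ((if a = j then 1 else 0) - q j) = p j - q j := by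
  simp [mul_sub, Finset.sum_sub_distrib, ← Finset.sum_mul, hp]

lemma sum_mul_indicator_sub_mul {p : α → ℝ} (hp : ∑ a, p a = 1) (q : α → ℝ) (j l : α) :
    (∑ a, p a * (((if a = j then 1 else 0) - q j) * ((if a = l then 1 else 0) - q l)))
      - (p j - q j) * (p l - q l) = (if j = l then p j else 0) - p j * p l := by
  have h : ∀ a, p a * (((if a = j then 1 else 0) - q j) * ((if a = l then 1 else 0) - q l)) =
      (if a = j then (if j = l then p j else 0) else 0) - (if a = j then p a * q l else 0)
        - (if a = l then p a * q j else 0) + p a * (q j * q l) := by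
    intro a
    by_cases h1 : a = j
    · subst h1
      by_cases h2 : a = l
      · subst h2; simp; ring
      · simp [h2]; ring
    · by_cases h2 : a = l
      · subst h2; simp [h1]; ring
      · simp [h1, h2]
  simp only [h, Finset.sum_add_distrib, Finset.sum_sub_distrib, ← Finset.sum_mul, hp]
  simp
  ring

lemma iidExp_crossStat {p : α → ℝ} (hp : ∑ a, p a = 1) (q : α → ℝ) :
    iidExp p (crossStat (σ := σ) q) = (Fintype.card σ : ℝ) ^ 2 * dampDist p q := by
  have h := iidExp_sum_type (σ := σ) p (fun x y => ∑ j, dampWeight q j *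
    ((∑ s, ((if x s = j then 1 else 0) - q j)) * ∑ t, ((if y t = j then 1 else 0) - q j)))
  have h1 : ∀ j, iidExp p (fun x : σ → α => ∑ s, ((if x s = j then (1 : ℝ) else 0) - q j)) =
      Fintype.card σ * (p j - q j) := by
    intro j
    rw [iidExp_sum]
    simp only [iidExp_apply hp (fun a => (if a = j then (1 : ℝ) else 0) - q j),
      sum_mul_indicator_sub hp]
    rw [Finset.sum_const, Finset.card_univ, nsmul_eq_mul]
  refine h.trans ?_
  simp only [iidExp_sum, iidExp_mul_left, iidExp_mul_right, h1]
  rw [dampDist, Finset.mul_sum]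
  exact Finset.sum_congr rfl fun j _ => by ring

lemma iidExp_crossStat_sq {p : α → ℝ} (hp : ∑ a, p a = 1) (q : α → ℝ) :
    iidExp p (fun z => crossStat (σ := σ) q z ^ 2) =
      ∑ j, ∑ l, dampWeight q j * dampWeight q l *
        (Fintype.card σ * ((if j = l then p j else 0) - p j * p l)
          + (Fintype.card σ : ℝ) ^ 2 * ((p j - q j) * (p l - q l))) ^ 2 := by
  have h1 : ∀ j l, iidExp p (fun x : σ → α =>
      (∑ s, ((if x s = j then (1 : ℝ) else 0) - q j)) *
        ∑ s, ((if x s = l then (1 : ℝ) else 0) - q l)) =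
      (Fintype.card σ * ((if j = l then p j else 0) - p j * p l)
          + (Fintype.card σ : ℝ) ^ 2 * ((p j - q j) * (p l - q l))) := by
    intro j l
    rw [iidExp_sum_mul_sum hp (fun a => (if a = j then (1 : ℝ) else 0) - q j)
      (fun a => (if a = l then (1 : ℝ) else 0) - q l)]
    simp only [sum_mul_indicator_sub hp, sum_mul_indicator_sub_mul hp]
  have h := iidExp_sum_type (σ := σ) p (fun x y => ∑ j, ∑ l, dampWeight q j * dampWeight q l *
    (((∑ s, ((if x s = j then 1 else 0) - q j)) * (∑ s, ((if x s = l then 1 else 0) - q l))) *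
    ((∑ t, ((if y t = j then 1 else 0) - q j)) * ∑ t, ((if y t = l then 1 else 0) - q l))))
  have h2 : ∀ z, crossStat (σ := σ) q z ^ 2 = ∑ j, ∑ l, dampWeight q j * dampWeight q l *
    (((∑ s, ((if (z ∘ Sum.inl) s = j then 1 else 0) - q j)) *
      (∑ s, ((if (z ∘ Sum.inl) s = l then 1 else 0) - q l))) *
    ((∑ t, ((if (z ∘ Sum.inr) t = j then 1 else 0) - q j)) *
      ∑ t, ((if (z ∘ Sum.inr) t = l then 1 else 0) - q l))) := by
    intro z
    rw [crossStat, sq, Finset.sum_mul_sum]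
    refine Finset.sum_congr rfl fun j _ => Finset.sum_congr rfl fun l _ => ?_
    simp only [Function.comp]
    ring
  simp only [h2]
  rw [h]
  simp only [iidExp_sum, iidExp_mul_left, iidExp_mul_right, h1]
  exact Finset.sum_congr rfl fun j _ => Finset.sum_congr rfl fun l _ => by ring

/-- The variance of the statistic is at most the sum of two terms: the fluctuations of the two
batches against each other, and those of either batch against the mean deviation of the other. -/
lemma iidExp_crossStat_sq_le {p q : α → ℝ} (hp0 : ∀ a, 0 ≤ p a) (hp : ∑ a, p a = 1) :
    iidExp p (fun z => crossStat (σ := σ) q z ^ 2) ≤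
      ((Fintype.card σ : ℝ) ^ 2 * dampDist p q) ^ 2
      + 2 * (Fintype.card σ : ℝ) ^ 2 * ∑ j, (dampWeight q j * p j) ^ 2
      + 2 * (Fintype.card σ : ℝ) ^ 3 * ∑ j, p j * (dampWeight q j * (p j - q j)) ^ 2 := by
  rw [iidExp_crossStat_sq hp]
  set m : ℝ := (Fintype.card σ : ℝ)
  set a := dampWeight q
  have hm : 0 ≤ m := Nat.cast_nonneg _
  have e1 : ∀ j l, a j * a l * (m * ((if j = l then p j else 0) - p j * p l)
          + m ^ 2 * ((p j - q j) * (p l - q l))) ^ 2 =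
      m ^ 2 * (if j = l then (a j * p j) ^ 2 * (1 - 2 * p j) else 0)
      + m ^ 2 * ((a j * p j ^ 2) * (a l * p l ^ 2))
      + 2 * m ^ 3 * (if j = l then p j * (a j * (p j - q j)) ^ 2 else 0)
      - 2 * m ^ 3 * ((a j * p j * (p j - q j)) * (a l * p l * (p l - q l)))
      + m ^ 4 * ((a j * (p j - q j) ^ 2) * (a l * (p l - q l) ^ 2)) := by
    intro j l
    by_cases h : j = l
    · subst h; simp; ring
    · simp [h]; ring
  simp only [e1, Finset.sum_add_distrib, Finset.sum_sub_distrib, ← Finset.mul_sum,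
    Finset.sum_ite_eq, Finset.mem_univ, if_true, ← Finset.sum_mul]
  have j1 : (∑ j, a j * p j ^ 2) * (∑ j, a j * p j ^ 2) ≤ ∑ j, (a j * p j) ^ 2 := by
    set c := ∑ j, a j * p j ^ 2 with hc
    have hv : 0 ≤ ∑ j, p j * (a j * p j - c) ^ 2 :=
      Finset.sum_nonneg fun j _ => mul_nonneg (hp0 j) (sq_nonneg _)
    have hv2 : ∑ j, p j * (a j * p j - c) ^ 2
        = ∑ j, p j * (a j * p j) ^ 2 - 2 * c * c + c ^ 2 := by
      have : ∀ j, p j * (a j * p j - c) ^ 2 =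
          p j * (a j * p j) ^ 2 - 2 * c * (a j * p j ^ 2) + p j * c ^ 2 := fun j => by ring
      simp only [this, Finset.sum_add_distrib, Finset.sum_sub_distrib, ← Finset.mul_sum,
        ← Finset.sum_mul, hp, ← hc]
      ring
    have hv3 : ∑ j, p j * (a j * p j) ^ 2 ≤ ∑ j, (a j * p j) ^ 2 := by
      refine Finset.sum_le_sum fun j _ => mul_le_of_le_one_left (sq_nonneg _) ?_
      rw [← hp]
      exact Finset.single_le_sum (fun i _ => hp0 i) (Finset.mem_univ j)
    nlinarith
  have j2 : ∑ j, (a j * p j) ^ 2 * (1 - 2 * p j) ≤ ∑ j, (a j * p j) ^ 2 :=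
    Finset.sum_le_sum fun j _ => mul_le_of_le_one_right (sq_nonneg _) (by linarith [hp0 j])
  have j3 := mul_self_nonneg (∑ j, a j * p j * (p j - q j))
  have hD : dampDist p q = ∑ j, a j * (p j - q j) ^ 2 := rfl
  rw [hD]
  have k1 := mul_le_mul_of_nonneg_left j1 (sq_nonneg m)
  have k2 := mul_le_mul_of_nonneg_left j2 (sq_nonneg m)
  have k3 : 0 ≤ 2 * m ^ 3 * ((∑ j, a j * p j * (p j - q j)) *
    (∑ j, a j * p j * (p j - q j))) := by positivity
  linarith

/-- Under the null hypothesis the statistic rarely exceeds a threshold of the order of its standard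
deviation, at most `m √(2/d)`. -/
lemma iidExp_le_crossStat_null {q : α → ℝ} (hq : ∀ a, 0 ≤ q a) (hq1 : ∑ a, q a = 1) {θ : ℝ}
    (hθ : 0 < θ) :
    iidExp q (fun z : σ ⊕ σ → α => if crossStat q z < θ then 0 else 1) ≤
      2 * (Fintype.card σ : ℝ) ^ 2 / (Fintype.card α * θ ^ 2) := by
  have h := iidExp_crossStat_sq_le (σ := σ) (q := q) hq hq1
  have hz : dampDist q q = 0 := by simp [dampDist]
  have h0 : ∑ j, q j * (dampWeight q j * (q j - q j)) ^ 2 = 0 := by simp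
  rw [hz, h0] at h
  have h2 : iidExp q (fun z : σ ⊕ σ → α => if crossStat q z < θ then 0 else 1) ≤
      iidExp q (fun z : σ ⊕ σ → α => 1 / θ ^ 2 * crossStat q z ^ 2) := by
    refine iidExp_mono hq fun z => ?_
    split_ifs with hc
    · positivity
    · rw [one_div_mul_eq_div, one_le_div (by positivity)]
      exact pow_le_pow_left₀ hθ.le (not_lt.mp hc) 2
  rw [iidExp_mul_left] at h2
  have h3 := sum_dampWeight_mul_sq_le hq hq1
  refine h2.trans ?_
  rw [one_div_mul_eq_div]
  have h4 : iidExp q (fun z : σ ⊕ σ → α => crossStat q z ^ 2) ≤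
      2 * (Fintype.card σ : ℝ) ^ 2 * (1 / Fintype.card α) := by
    refine h.trans ?_
    have := mul_le_mul_of_nonneg_left h3 (show 0 ≤ 2 * (Fintype.card σ : ℝ) ^ 2 by positivity)
    linarith
  calc _ ≤ 2 * (Fintype.card σ : ℝ) ^ 2 * (1 / Fintype.card α) / θ ^ 2 := by gcongr
    _ = _ := by rw [mul_one_div, div_div]

lemma crossStat_variance_arith {m d Z A B : ℝ} (hm : 0 < m) (hd : 1 ≤ d) (hZ : 0 < Z)
    (h1 : 40 ≤ m * √d * Z) (h2 : 40 ≤ m * √Z) (hA : A ≤ 2 * (1 / d) + 2 * Z)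
    (hB : B ≤ (1 / d + √Z) * Z) :
    2 * m ^ 2 * A + 2 * m ^ 3 * B ≤ m ^ 4 * Z ^ 2 / 8 := by
  have hr : √Z ^ 2 = Z := Real.sq_sqrt hZ.le
  have hr0 : 0 < √Z := Real.sqrt_pos.mpr hZ
  have hsd : √d ^ 2 = d := Real.sq_sqrt (by linarith)
  have hsd1 : 1 ≤ √d := by rw [← Real.sqrt_one]; exact Real.sqrt_le_sqrt hd
  have b1 : 40 * √Z ≤ m * Z := by
    calc 40 * √Z ≤ m * √Z * √Z := by gcongr
      _ = m * √Z ^ 2 := by ring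
      _ = m * Z := by rw [hr]
  have b2 : 40 * (1 / √d) ≤ m * Z := by
    rw [mul_one_div, div_le_iff₀ (by positivity)]
    linarith
  have b3 : 1 / d ≤ 1 / √d := by
    refine one_div_le_one_div_of_le (by positivity) ?_
    nlinarith
  have b4 : 1 / d = (1 / √d) ^ 2 := by rw [div_pow, hsd, one_pow]
  have hy : 0 ≤ 1 / √d := by positivity
  have hmZ : 0 ≤ m * Z := by positivity
  have c1 : 1600 * (1 / d) ≤ m ^ 2 * Z ^ 2 := by
    have := mul_self_le_mul_self (by positivity) b2
    rw [b4]
    linarith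
  have c2 : 1600 * Z ≤ m ^ 2 * Z ^ 2 := by
    have := mul_self_le_mul_self (by positivity) b1
    linarith
  have c3 : 40 * (1 / d) ≤ m * Z := by linarith
  have k1 := mul_le_mul_of_nonneg_left hA (show 0 ≤ 2 * m ^ 2 by positivity)
  have k2 := mul_le_mul_of_nonneg_left hB (show 0 ≤ 2 * m ^ 3 by positivity)
  have l1 := mul_le_mul_of_nonneg_left c1 (sq_nonneg m)
  have l2 := mul_le_mul_of_nonneg_left c2 (sq_nonneg m)
  have l3 := mul_le_mul_of_nonneg_left c3 (show 0 ≤ m ^ 3 * Z by positivity)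
  have l4 := mul_le_mul_of_nonneg_left b1 (show 0 ≤ m ^ 3 * Z by positivity)
  have l5 : 0 ≤ m ^ 4 * Z ^ 2 := by positivity
  linarith

/-- Chebyshev's inequality under the alternative: at distance `dampDist p q ≥ τ` the statistic is
below half its smallest possible mean with probability at most `1/2`. -/
lemma iidExp_crossStat_far {p q : α → ℝ} (hp : ∀ a, 0 ≤ p a) (hp1 : ∑ a, p a = 1)
    (hq : ∀ a, 0 ≤ q a) (hq1 : ∑ a, q a = 1) {τ : ℝ} (hτ : 0 < τ) (hZ : τ ≤ dampDist p q)
    (h1 : 40 ≤ Fintype.card σ * √(Fintype.card α) * τ) (h2 : 40 ≤ Fintype.card σ * √τ) :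
    iidExp p (fun z : σ ⊕ σ → α =>
      if crossStat q z < (Fintype.card σ : ℝ) ^ 2 * τ / 2 then 1 else 0) ≤ 1 / 2 := by
  have hsq := iidExp_crossStat_sq_le (σ := σ) (q := q) hp hp1
  have hmean := iidExp_crossStat (σ := σ) hp1 q
  set m : ℝ := (Fintype.card σ : ℝ)
  set Z := dampDist p q with hZdef
  have hm : 0 ≤ m := Nat.cast_nonneg _
  have hmpos : 0 < m := by
    rcases hm.lt_or_eq with h | h
    · exact h
    · rw [← h] at h2; norm_num at h2
  have hZ0 : 0 < Z := hτ.trans_le hZ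
  have hne : Nonempty α := by
    by_contra hc
    have := not_nonempty_iff.mp hc
    simp at hp1
  have hd : 0 < (Fintype.card α : ℝ) := by exact_mod_cast Fintype.card_pos
  have hd1 : 1 ≤ (Fintype.card α : ℝ) := by exact_mod_cast Fintype.card_pos
  set d : ℝ := (Fintype.card α : ℝ)
  have haδ : ∀ j, (dampWeight q j * (p j - q j)) ^ 2 ≤ dampWeight q j * (p j - q j) ^ 2 := by
    intro j
    have a1 := dampWeight_le_one hq j
    have a0 := (dampWeight_pos hq j).le
    rw [mul_pow, sq (dampWeight q j), mul_assoc]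
    exact mul_le_of_le_one_left (by positivity) a1
  have haZ : ∀ j, |dampWeight q j * (p j - q j)| ≤ √Z := by
    intro j
    rw [← Real.sqrt_sq_eq_abs]
    refine Real.sqrt_le_sqrt ((haδ j).trans ?_)
    exact Finset.single_le_sum (f := fun j => dampWeight q j * (p j - q j) ^ 2)
      (fun i _ => mul_nonneg (dampWeight_pos hq i).le (sq_nonneg _)) (Finset.mem_univ j)
  have v1 : ∑ j, (dampWeight q j * p j) ^ 2 ≤ 2 * (1 / d) + 2 * Z := by
    have h3 := sum_dampWeight_mul_sq_le hq hq1
    calc ∑ j, (dampWeight q j * p j) ^ 2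
        ≤ ∑ j, (2 * (dampWeight q j * q j) ^ 2 + 2 * (dampWeight q j * (p j - q j) ^ 2)) := by
          refine Finset.sum_le_sum fun j _ => ?_
          have := haδ j
          nlinarith [sq_nonneg (dampWeight q j * q j - dampWeight q j * (p j - q j))]
      _ = 2 * ∑ j, (dampWeight q j * q j) ^ 2 + 2 * Z := by
          rw [Finset.sum_add_distrib, ← Finset.mul_sum, ← Finset.mul_sum]; rfl
      _ ≤ _ := by linarith
  have v2 : ∑ j, p j * (dampWeight q j * (p j - q j)) ^ 2 ≤ (1 / d + √Z) * Z := by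
    change _ ≤ (1 / d + √Z) * ∑ j, dampWeight q j * (p j - q j) ^ 2
    rw [Finset.mul_sum]
    refine Finset.sum_le_sum fun j _ => ?_
    have e : p j * (dampWeight q j * (p j - q j)) ^ 2 =
      (dampWeight q j * q j + dampWeight q j * (p j - q j)) *
        (dampWeight q j * (p j - q j) ^ 2) := by ring
    rw [e]
    exact mul_le_mul_of_nonneg_right
      (add_le_add (dampWeight_mul_le hq j) ((le_abs_self _).trans (haZ j)))
      (mul_nonneg (dampWeight_pos hq j).le (sq_nonneg _))
  have hvar : iidExp p (fun z : σ ⊕ σ → α => (crossStat q z - m ^ 2 * Z) ^ 2) ≤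
      m ^ 4 * Z ^ 2 / 8 := by
    have e : ∀ z : σ ⊕ σ → α, (crossStat q z - m ^ 2 * Z) ^ 2 =
        (crossStat q z ^ 2 + (-2 * (m ^ 2 * Z)) * crossStat q z) + (m ^ 2 * Z) ^ 2 :=
      fun z => by ring
    simp only [e]
    rw [iidExp_add, iidExp_add, iidExp_mul_left, iidExp_const hp1, hmean]
    have b0 : 40 ≤ m * √Z := h2.trans (by gcongr)
    have b1 : 40 ≤ m * √d * Z := h1.trans (by gcongr)
    have := crossStat_variance_arith hmpos hd1 hZ0 b1 b0 v1 v2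
    linarith
  have hcheb : iidExp p (fun z : σ ⊕ σ → α => if crossStat q z < m ^ 2 * τ / 2 then 1 else 0) ≤
      iidExp p (fun z : σ ⊕ σ → α => 4 / (m ^ 4 * Z ^ 2) * (crossStat q z - m ^ 2 * Z) ^ 2) := by
    refine iidExp_mono hp fun z => ?_
    split_ifs with hc
    · rw [div_mul_eq_mul_div, one_le_div (by positivity)]
      have : m ^ 2 * τ ≤ m ^ 2 * Z := by gcongr
      have h3 : m ^ 2 * Z / 2 ≤ m ^ 2 * Z - crossStat q z := by linarith
      have h4 := pow_le_pow_left₀ (by positivity) h3 2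
      nlinarith
    · positivity
  rw [iidExp_mul_left] at hcheb
  refine hcheb.trans ?_
  calc _ ≤ 4 / (m ^ 4 * Z ^ 2) * (m ^ 4 * Z ^ 2 / 8) := by gcongr
    _ = 1 / 2 := by field_simp; norm_num

end IdentityTest

/-! ### Hypercontractivity on the discrete cube -/

section Cube

variable {ι : Type} [DecidableEq ι]

/-- The sign `±1` of a Boolean. -/
def boolSign (b : Bool) : ℝ := if b then 1 else -1

lemma boolSign_mul_self (b : Bool) : boolSign b * boolSign b = 1 := by
  cases b <;> simp [boolSign]

lemma boolSign_not (b : Bool) : boolSign (!b) = -boolSign b := by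
  cases b <;> simp [boolSign]

/-- Flipping the sign of the variable `i`. -/
def flipAt (i : ι) (x : ι → Bool) : ι → Bool := Function.update x i (!x i)

lemma flipAt_involutive (i : ι) : Function.Involutive (flipAt i) := fun x => by
  simp [flipAt]

variable [Fintype ι]

/-- The Walsh character `x ↦ ∏_{i ∈ S} x_i` on the discrete cube. -/
def walsh (S : Finset ι) (x : ι → Bool) : ℝ := ∏ i, if i ∈ S then boolSign (x i) else 1

/-- Functions on the discrete cube whose Fourier–Walsh expansion uses only the variables in `s` and
has degree at most `k`. -/
def lowDegOn (s : Finset ι) (k : ℕ) : Submodule ℝ ((ι → Bool) → ℝ) :=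
  Submodule.span ℝ {f | ∃ S : Finset ι, S ⊆ s ∧ S.card ≤ k ∧ f = walsh S}

lemma walsh_empty : walsh (∅ : Finset ι) = fun _ => 1 := by
  funext x; simp [walsh]

lemma walsh_singleton (i : ι) : walsh {i} = fun x => boolSign (x i) := by
  funext x; simp [walsh]

lemma walsh_mul (S T : Finset ι) : walsh S * walsh T = walsh (symmDiff S T) := by
  funext x
  simp only [Pi.mul_apply, walsh, ← Finset.prod_mul_distrib]
  refine Finset.prod_congr rfl fun i _ => ?_
  by_cases h1 : i ∈ S <;> by_cases h2 : i ∈ T <;>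
    simp [Finset.mem_symmDiff, h1, h2, boolSign_mul_self]

lemma walsh_eq_mul_erase {S : Finset ι} {i : ι} (hi : i ∈ S) (x : ι → Bool) :
    walsh S x = boolSign (x i) * walsh (S.erase i) x := by
  have h := congrFun (walsh_mul {i} (S.erase i)) x
  have : symmDiff {i} (S.erase i) = S := by
    ext j
    by_cases hj : j = i
    · subst hj; simp [Finset.mem_symmDiff, hi]
    · simp [Finset.mem_symmDiff, hj]
  rw [this, Pi.mul_apply, walsh_singleton] at h
  exact h.symm

lemma walsh_flipAt {S : Finset ι} {i : ι} (hi : i ∉ S) (x : ι → Bool) :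
    walsh S (flipAt i x) = walsh S x := by
  refine Finset.prod_congr rfl fun j _ => ?_
  by_cases hj : j ∈ S
  · have : j ≠ i := fun h => hi (h ▸ hj)
    simp [hj, flipAt, Function.update_of_ne this]
  · simp [hj]

lemma lowDegOn_flipAt {s : Finset ι} {k : ℕ} {i : ι} (hi : i ∉ s) {f : (ι → Bool) → ℝ}
    (hf : f ∈ lowDegOn s k) (x : ι → Bool) : f (flipAt i x) = f x := by
  induction hf using Submodule.span_induction with
  | mem f h =>
    obtain ⟨S, hS, -, rfl⟩ := h
    exact walsh_flipAt (fun h => hi (hS h)) x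
  | zero => rfl
  | add f g _ _ hf hg => simp [hf, hg]
  | smul c f _ hf => simp [hf]

lemma expect_boolSign_mul {i : ι} {F : (ι → Bool) → ℝ} (hF : ∀ x, F (flipAt i x) = F x) :
    𝔼 x, boolSign (x i) * F x = 0 := by
  have h : 𝔼 x, boolSign (x i) * F x = 𝔼 x, -(boolSign (x i) * F x) := by
    refine Fintype.expect_equiv (flipAt_involutive i).toPerm _ _ fun x => ?_
    simp only [Function.Involutive.coe_toPerm, hF]
    simp [flipAt, boolSign_not]
  rw [Finset.expect_neg_distrib] at h
  linarith

/-- Splitting off the dependence on one variable. In degree `0` there is none; the truncated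
subtraction `k - 1` is harmless because of the last conjunct. -/
lemma lowDegOn_insert {s : Finset ι} {k : ℕ} {i : ι} {f : (ι → Bool) → ℝ}
    (hf : f ∈ lowDegOn (insert i s) k) :
    ∃ g ∈ lowDegOn s k, ∃ h ∈ lowDegOn s (k - 1),
      (∀ x, f x = g x + boolSign (x i) * h x) ∧ (k = 0 → h = 0) := by
  induction hf using Submodule.span_induction with
  | mem f hf =>
    obtain ⟨S, hS, hk, rfl⟩ := hf
    by_cases hi : i ∈ S
    · refine ⟨0, Submodule.zero_mem _, walsh (S.erase i),
        Submodule.subset_span ⟨_, ?_, ?_, rfl⟩, fun x => ?_, fun h => ?_⟩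
      · exact (Finset.erase_subset_erase i hS).trans (Finset.erase_insert_subset i s)
      · rw [Finset.card_erase_of_mem hi]; omega
      · rw [walsh_eq_mul_erase hi]; simp
      · have := Finset.card_pos.mpr ⟨i, hi⟩
        omega
    · refine ⟨walsh S, Submodule.subset_span ⟨S, ?_, hk, rfl⟩, 0, Submodule.zero_mem _,
        fun x => by simp, fun _ => rfl⟩
      exact (Finset.subset_insert_iff_of_notMem hi).mp hS
  | zero => exact ⟨0, Submodule.zero_mem _, 0, Submodule.zero_mem _, by simp, by simp⟩
  | add f₁ f₂ _ _ h₁ h₂ =>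
    obtain ⟨g₁, hg₁, k₁, hk₁, e₁, z₁⟩ := h₁
    obtain ⟨g₂, hg₂, k₂, hk₂, e₂, z₂⟩ := h₂
    refine ⟨g₁ + g₂, Submodule.add_mem _ hg₁ hg₂, k₁ + k₂, Submodule.add_mem _ hk₁ hk₂,
      fun x => ?_, fun h => by rw [z₁ h, z₂ h, add_zero]⟩
    simp only [Pi.add_apply, e₁, e₂]; ring
  | smul c f _ hf =>
    obtain ⟨g, hg, k', hk', e, z⟩ := hf
    refine ⟨c • g, Submodule.smul_mem _ _ hg, c • k', Submodule.smul_mem _ _ hk',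
      fun x => ?_, fun h => by rw [z h, smul_zero]⟩
    simp only [Pi.smul_apply, smul_eq_mul, e]; ring

lemma sq_expect_mul_le {Ω : Type} [Fintype Ω] (f g : Ω → ℝ) :
    (𝔼 x, f x * g x) ^ 2 ≤ (𝔼 x, f x ^ 2) * 𝔼 x, g x ^ 2 := by
  have h := Finset.sum_mul_sq_le_sq_mul_sq Finset.univ f g
  simp only [Fintype.expect_eq_sum_div_card]
  rw [div_pow, div_mul_div_comm, ← sq]
  gcongr

/-- Bonami's inequality: functions of degree at most `k` on the discrete cube are
`(2,4)`-hypercontractive with constant `9 ^ k`. -/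
lemma expect_pow_four_le_on (s : Finset ι) : ∀ (k : ℕ) (f : (ι → Bool) → ℝ), f ∈ lowDegOn s k →
    𝔼 x, f x ^ 4 ≤ 9 ^ k * (𝔼 x, f x ^ 2) ^ 2 := by
  induction s using Finset.induction_on with
  | empty =>
    intro k f hf
    have hc : ∃ c : ℝ, f = fun _ => c := by
      induction hf using Submodule.span_induction with
      | mem f h =>
        obtain ⟨S, hS, -, rfl⟩ := h
        rw [Finset.subset_empty.mp hS, walsh_empty]
        exact ⟨1, rfl⟩
      | zero => exact ⟨0, rfl⟩
      | add f g _ _ hf hg =>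
        obtain ⟨a, rfl⟩ := hf
        obtain ⟨b, rfl⟩ := hg
        exact ⟨a + b, rfl⟩
      | smul c f _ hf =>
        obtain ⟨a, rfl⟩ := hf
        exact ⟨c * a, rfl⟩
    obtain ⟨c, rfl⟩ := hc
    simp only [Fintype.expect_const]
    have h1 : (1 : ℝ) ≤ 9 ^ k := one_le_pow₀ (by norm_num)
    have : (c ^ 2) ^ 2 = c ^ 4 := by ring
    rw [this]
    exact le_mul_of_one_le_left (by positivity) h1
  | insert i s hi ih =>
    intro k f hf
    obtain ⟨g, hg, h, hh, hfe, hk0⟩ := lowDegOn_insert hf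
    have gi := fun x => lowDegOn_flipAt hi hg x
    have hi' := fun x => lowDegOn_flipAt hi hh x
    have E2 : 𝔼 x, f x ^ 2 = 𝔼 x, g x ^ 2 + 𝔼 x, h x ^ 2 := by
      have e : ∀ x, f x ^ 2 = g x ^ 2 + h x ^ 2 + boolSign (x i) * (2 * (g x * h x)) := by
        intro x
        rw [hfe]
        linear_combination h x ^ 2 * boolSign_mul_self (x i)
      simp only [e, Finset.expect_add_distrib]
      rw [expect_boolSign_mul (fun x => by simp only [gi, hi']), add_zero]
    have E4 : 𝔼 x, f x ^ 4 = 𝔼 x, g x ^ 4 + 6 * 𝔼 x, g x ^ 2 * h x ^ 2 + 𝔼 x, h x ^ 4 := by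
      have e : ∀ x, f x ^ 4 = g x ^ 4 + 6 * (g x ^ 2 * h x ^ 2) + h x ^ 4
          + boolSign (x i) * (4 * g x ^ 3 * h x + 4 * g x * h x ^ 3) := by
        intro x
        rw [hfe]
        linear_combination (6 * g x ^ 2 * h x ^ 2 + 4 * g x * h x ^ 3 * boolSign (x i)
          + h x ^ 4 * (boolSign (x i) * boolSign (x i) + 1)) * boolSign_mul_self (x i)
      simp only [e, Finset.expect_add_distrib, ← Finset.mul_expect]
      rw [expect_boolSign_mul (fun x => by simp only [gi, hi']), add_zero]
    have Eg := ih k g hg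
    have cs := sq_expect_mul_le (fun x => g x ^ 2) (fun x => h x ^ 2)
    have p4 : ∀ y : ℝ, (y ^ 2) ^ 2 = y ^ 4 := fun y => by ring
    simp only [p4] at cs
    have hG : 0 ≤ 𝔼 x, g x ^ 2 := Finset.expect_nonneg fun x _ => sq_nonneg _
    have hH : 0 ≤ 𝔼 x, h x ^ 2 := Finset.expect_nonneg fun x _ => sq_nonneg _
    have hH4 : 0 ≤ 𝔼 x, h x ^ 4 := Finset.expect_nonneg fun x _ => by positivity
    rw [E4, E2]
    rcases Nat.eq_zero_or_pos k with rfl | hk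
    · have hz : h = 0 := hk0 rfl
      subst hz
      simpa using Eg
    obtain ⟨k, rfl⟩ : ∃ k', k = k' + 1 := ⟨k - 1, by omega⟩
    have Eh := ih k h hh
    have hc : 0 < (9 : ℝ) ^ k := by positivity
    rw [pow_succ] at Eg ⊢
    generalize (𝔼 x, g x ^ 2) = G at *
    generalize (𝔼 x, h x ^ 2) = H at *
    generalize (𝔼 x, g x ^ 4) = G4 at *
    generalize (𝔼 x, h x ^ 4) = H4 at *
    generalize (𝔼 x, g x ^ 2 * h x ^ 2) = X at *
    generalize (9 : ℝ) ^ k = c at *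
    have hX : X ≤ 3 * c * (G * H) := by
      refine le_of_sq_le_sq ?_ (by positivity)
      calc X ^ 2 ≤ G4 * H4 := cs
        _ ≤ (c * 9 * G ^ 2) * (c * H ^ 2) := by gcongr
        _ = _ := by ring
    nlinarith [mul_nonneg hc.le (sq_nonneg H)]

/-- Functions of degree at most `k` on the discrete cube. -/
abbrev lowDeg (ι : Type) [Fintype ι] [DecidableEq ι] (k : ℕ) : Submodule ℝ ((ι → Bool) → ℝ) :=
  lowDegOn Finset.univ k

lemma const_mem_lowDeg (k : ℕ) (c : ℝ) : (fun _ => c) ∈ lowDeg ι k := by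
  have : (fun _ : ι → Bool => c) = c • walsh ∅ := by
    funext x; simp [walsh_empty]
  rw [this]
  exact Submodule.smul_mem _ _ (Submodule.subset_span ⟨∅, by simp, by simp, rfl⟩)

lemma boolSign_mem_lowDeg (i : ι) : (fun x => boolSign (x i)) ∈ lowDeg ι 1 :=
  Submodule.subset_span ⟨{i}, by simp, by simp, (walsh_singleton i).symm⟩

lemma mul_mem_lowDeg {k l : ℕ} {f g : (ι → Bool) → ℝ} (hf : f ∈ lowDeg ι k)
    (hg : g ∈ lowDeg ι l) : (fun x => f x * g x) ∈ lowDeg ι (k + l) := by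
  have h := Submodule.mul_mem_mul hf hg
  simp only [lowDeg, lowDegOn, Submodule.span_mul_span] at h
  refine Submodule.span_mono ?_ h
  rintro _ ⟨_, ⟨S, -, hS, rfl⟩, _, ⟨T, -, hT, rfl⟩, rfl⟩
  refine ⟨symmDiff S T, by simp, ?_, walsh_mul S T⟩
  have : symmDiff S T ⊆ S ∪ T := by
    intro j hj
    rw [Finset.mem_symmDiff] at hj
    rw [Finset.mem_union]
    tauto
  exact ((Finset.card_le_card this).trans (Finset.card_union_le S T)).trans (by omega)

/-- Complex-valued functions on the discrete cube of degree at most `k`. -/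
def ComplexLowDeg (k : ℕ) (f : (ι → Bool) → ℂ) : Prop :=
  (fun x => (f x).re) ∈ lowDeg ι k ∧ (fun x => (f x).im) ∈ lowDeg ι k

lemma ComplexLowDeg.const (k : ℕ) (c : ℂ) : ComplexLowDeg (ι := ι) k (fun _ => c) :=
  ⟨const_mem_lowDeg _ _, const_mem_lowDeg _ _⟩

lemma ComplexLowDeg.mul {k l : ℕ} {f g : (ι → Bool) → ℂ} (hf : ComplexLowDeg k f)
    (hg : ComplexLowDeg l g) : ComplexLowDeg (k + l) (fun x => f x * g x) := by
  constructor
  · simp only [Complex.mul_re]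
    exact Submodule.sub_mem _ (mul_mem_lowDeg hf.1 hg.1) (mul_mem_lowDeg hf.2 hg.2)
  · simp only [Complex.mul_im]
    exact Submodule.add_mem _ (mul_mem_lowDeg hf.1 hg.2) (mul_mem_lowDeg hf.2 hg.1)

lemma ComplexLowDeg.const_mul {k : ℕ} {f : (ι → Bool) → ℂ} (c : ℂ) (hf : ComplexLowDeg k f) :
    ComplexLowDeg k (fun x => c * f x) := by
  simpa using (ComplexLowDeg.const 0 c).mul hf

lemma ComplexLowDeg.star {k : ℕ} {f : (ι → Bool) → ℂ} (hf : ComplexLowDeg k f) :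
    ComplexLowDeg k (fun x => star (f x)) := by
  refine ⟨by simpa using hf.1, ?_⟩
  have := Submodule.neg_mem _ hf.2
  exact this

lemma ComplexLowDeg.sum {κ : Type} {k : ℕ} (S : Finset κ) {f : κ → (ι → Bool) → ℂ}
    (hf : ∀ j, ComplexLowDeg k (f j)) : ComplexLowDeg k (fun x => ∑ j ∈ S, f j x) := by
  constructor
  · have := Submodule.sum_mem (lowDeg ι k) (t := S) fun j _ => (hf j).1
    convert this using 1
    funext x
    simp
  · have := Submodule.sum_mem (lowDeg ι k) (t := S) fun j _ => (hf j).2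
    convert this using 1
    funext x
    simp

/-- By hypercontractivity the first absolute moment of a function of degree at most `4` is
comparable to its root mean square. -/
lemma sqrt_expect_sq_le {f : (ι → Bool) → ℝ} (hf : f ∈ lowDeg ι 4) :
    √(𝔼 x, f x ^ 2) ≤ 216 * 𝔼 x, |f x| := by
  have h4 := expect_pow_four_le_on _ 4 f hf
  have hE : 0 ≤ 𝔼 x, f x ^ 2 := Finset.expect_nonneg fun x _ => sq_nonneg _
  have hA : 0 ≤ 𝔼 x, |f x| := Finset.expect_nonneg fun x _ => abs_nonneg _
  have hs2 : √(𝔼 x, f x ^ 2) ^ 2 = 𝔼 x, f x ^ 2 := Real.sq_sqrt hE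
  rcases (Real.sqrt_nonneg (𝔼 x, f x ^ 2)).eq_or_lt with h0 | hs
  · rw [← h0]; positivity
  set s := √(𝔼 x, f x ^ 2)
  -- Splitting at `|y| = A` gives `y² ≤ A|y| + y⁴/A²`; at `A = 162 s` the last term averages to `s²/4`.
  have pt : ∀ y : ℝ, y ^ 2 ≤ 162 * s * |y| + 1 / (162 * s) ^ 2 * y ^ 4 := by
    intro y
    have hy : y ^ 2 = |y| ^ 2 := (sq_abs y).symm
    have hy4 : y ^ 4 = |y| ^ 4 := by rw [show 4 = 2 * 2 from rfl, pow_mul, pow_mul, sq_abs]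
    rw [hy, hy4]
    have hn := abs_nonneg y
    generalize |y| = t at hn
    rcases le_total t (162 * s) with h | h
    · have h1 : 0 ≤ 1 / (162 * s) ^ 2 * t ^ 4 := by positivity
      nlinarith
    · have h1 : t ^ 2 ≤ 1 / (162 * s) ^ 2 * t ^ 4 := by
        rw [one_div_mul_eq_div, le_div_iff₀ (by positivity)]
        have := pow_le_pow_left₀ (by positivity) h 2
        nlinarith [sq_nonneg t]
      have h2 : 0 ≤ 162 * s * t := by positivity
      linarith
  have hint : 𝔼 x, f x ^ 2 ≤ 162 * s * (𝔼 x, |f x|) + 1 / (162 * s) ^ 2 * 𝔼 x, f x ^ 4 := by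
    rw [Finset.mul_expect, Finset.mul_expect, ← Finset.expect_add_distrib]
    exact Finset.expect_le_expect fun x _ => pt (f x)
  rw [← hs2] at hint h4
  have h5 : 1 / (162 * s) ^ 2 * 𝔼 x, f x ^ 4 ≤ s ^ 2 / 4 := by
    calc _ ≤ 1 / (162 * s) ^ 2 * (9 ^ 4 * (s ^ 2) ^ 2) := by gcongr
      _ = _ := by field_simp; norm_num
  have h6 : s * (3 * s) ≤ s * (648 * 𝔼 x, |f x|) := by nlinarith
  have := le_of_mul_le_mul_left h6 hs
  linarith

/-- The Paley–Zygmund inequality for the `ℓ¹` norm of a vector of functions of degree at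
most `4`. -/
lemma expect_indicator_sum_abs_ge {α : Type} [Fintype α] {f : α → (ι → Bool) → ℝ}
    (hf : ∀ j, f j ∈ lowDeg ι 4) {w : ℝ} (hw : 432 * w ≤ ∑ j, √(𝔼 x, f j x ^ 2)) :
    1 / 432 ^ 2 ≤ 𝔼 x, if w ≤ ∑ j, |f j x| then (1 : ℝ) else 0 := by
  set S := ∑ j, √(𝔼 x, f j x ^ 2) with hS
  set W : (ι → Bool) → ℝ := fun x => ∑ j, |f j x| with hW
  set P := 𝔼 x, if w ≤ W x then (1 : ℝ) else 0 with hP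
  have hS0 : 0 ≤ S := Finset.sum_nonneg fun j _ => Real.sqrt_nonneg _
  have hW0 : ∀ x, 0 ≤ W x := fun x => Finset.sum_nonneg fun j _ => abs_nonneg _
  rcases hS0.eq_or_lt with h0 | hSpos
  · have : ∀ x, w ≤ W x := fun x => by have := hW0 x; linarith
    simp only [this, if_true, Fintype.expect_const] at hP
    rw [hP]; norm_num
  have hEW : S / 216 ≤ 𝔼 x, W x := by
    rw [hW, Finset.expect_sum_comm, hS, Finset.sum_div]
    refine Finset.sum_le_sum fun j _ => ?_
    have := sqrt_expect_sq_le (hf j)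
    linarith
  have hEW2 : 𝔼 x, W x ^ 2 ≤ S ^ 2 := by
    have e : ∀ x, W x ^ 2 = ∑ j, ∑ l, |f j x| * |f l x| := fun x => by
      rw [sq, hW, Finset.sum_mul_sum]
    simp only [e]
    rw [Finset.expect_sum_comm, hS, sq, Finset.sum_mul_sum]
    refine Finset.sum_le_sum fun j _ => ?_
    rw [Finset.expect_sum_comm]
    refine Finset.sum_le_sum fun l _ => ?_
    rw [← Real.sqrt_mul (Finset.expect_nonneg fun x _ => sq_nonneg _)]
    refine Real.le_sqrt_of_sq_le ((sq_expect_mul_le _ _).trans (le_of_eq ?_))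
    simp only [sq_abs]
  have hsplit : 𝔼 x, W x ≤ S / 432 + 𝔼 x, W x * (if w ≤ W x then 1 else 0) := by
    rw [← Fintype.expect_const (ι := ι → Bool) (S / 432), ← Finset.expect_add_distrib]
    refine Finset.expect_le_expect fun x _ => ?_
    split_ifs with h
    · linarith
    · linarith [not_le.mp h]
  have hcs := sq_expect_mul_le W (fun x => if w ≤ W x then (1 : ℝ) else 0)
  have e2 : ∀ x, (if w ≤ W x then (1 : ℝ) else 0) ^ 2 = if w ≤ W x then 1 else 0 := fun x => by
    split_ifs <;> norm_num
  simp only [e2] at hcs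
  have hP0 : 0 ≤ P := Finset.expect_nonneg fun x _ => by split_ifs <;> norm_num
  have h1 : S / 432 ≤ 𝔼 x, W x * (if w ≤ W x then 1 else 0) := by linarith
  have h2 : (S / 432) ^ 2 ≤ S ^ 2 * P :=
    (pow_le_pow_left₀ (by positivity) h1 2).trans
      (hcs.trans (mul_le_mul_of_nonneg_right hEW2 hP0))
  have h3 : S ^ 2 * (1 / 432 ^ 2) ≤ S ^ 2 * P := by
    refine le_trans (le_of_eq ?_) h2
    ring
  exact le_of_mul_le_mul_left h3 (by positivity)

end Cube

/-! ### The diamond norm and the Choi matrix -/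

section TraceNorm

variable {ι : Type} [Fintype ι] [DecidableEq ι]

lemma traceNorm_eq_sum_fin (A : Matrix ι ι ℂ) :
    traceNorm A = ∑ i : Fin (Fintype.card ι), (Matrix.toEuclideanLin A).singularValues i := by
  rw [traceNorm, Finset.sum_range]

/-- The right singular vectors of a matrix: an orthonormal basis whose images are orthogonal, with
norms the singular values. -/
lemma exists_singular_basis (A : Matrix ι ι ℂ) :
    ∃ b : OrthonormalBasis (Fin (Fintype.card ι)) ℂ (EuclideanSpace ℂ ι), ∀ i j,
      inner ℂ (Matrix.toEuclideanLin A (b i)) (Matrix.toEuclideanLin A (b j)) =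
        if i = j then (((Matrix.toEuclideanLin A).singularValues i : ℂ)) ^ 2 else 0 := by
  set T := Matrix.toEuclideanLin A
  have hn : Module.finrank ℂ (EuclideanSpace ℂ ι) = Fintype.card ι := finrank_euclideanSpace
  refine ⟨T.isSymmetric_adjoint_comp_self.eigenvectorBasis hn, fun i j => ?_⟩
  have h := T.isSymmetric_adjoint_comp_self.apply_eigenvectorBasis hn j
  rw [LinearMap.comp_apply] at h
  rw [← LinearMap.adjoint_inner_right, h, inner_smul_right,
    orthonormal_iff_ite.mp (OrthonormalBasis.orthonormal _) i j]
  by_cases hij : i = j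
  · subst hij
    rw [if_pos rfl, if_pos rfl, ← T.sq_singularValues_fin hn]
    simp
  · simp [hij]

lemma norm_toEuclideanLin_of_singular_basis {A : Matrix ι ι ℂ} {i : Fin (Fintype.card ι)}
    {v : EuclideanSpace ℂ ι}
    (h : inner ℂ (Matrix.toEuclideanLin A v) (Matrix.toEuclideanLin A v) =
        (((Matrix.toEuclideanLin A).singularValues i : ℂ)) ^ 2) :
    ‖Matrix.toEuclideanLin A v‖ = (Matrix.toEuclideanLin A).singularValues i := by
  rw [inner_self_eq_norm_sq_to_K] at h
  have h2 : ‖Matrix.toEuclideanLin A v‖ ^ 2 = (Matrix.toEuclideanLin A).singularValues i ^ 2 :=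
    Complex.ofReal_injective (by push_cast; simpa using h)
  exact (pow_left_inj₀ (norm_nonneg _) (LinearMap.singularValues_nonneg _ _) two_ne_zero).mp h2

/-- Half of the duality between the trace norm and the operator norm: some contraction `R` attains
`‖A‖₁ = tr (A R)`. -/
lemma exists_contraction_traceNorm_eq (A : Matrix ι ι ℂ) :
    ∃ R : Matrix ι ι ℂ, (∀ z : ι → ℂ, ∑ p, ‖(R *ᵥ z) p‖ ^ 2 ≤ ∑ p, ‖z p‖ ^ 2) ∧
      (traceNorm A : ℂ) = (A * R).trace := by
  obtain ⟨b, hb⟩ := exists_singular_basis A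
  set T := Matrix.toEuclideanLin A with hT
  set u : Fin (Fintype.card ι) → EuclideanSpace ℂ ι :=
    fun i => ((T.singularValues i : ℂ))⁻¹ • T (b i) with hu
  have huu : ∀ i j, inner ℂ (u i) (u j) =
      if i = j then (if T.singularValues i = 0 then (0 : ℂ) else 1) else 0 := by
    intro i j
    simp only [hu, inner_smul_left, inner_smul_right, hb i j]
    by_cases hij : i = j
    · subst hij
      by_cases h0 : T.singularValues i = 0
      · simp [h0]
      · have : (T.singularValues i : ℂ) ≠ 0 := by exact_mod_cast h0
        simp only [if_true, h0, if_false, map_inv₀, Complex.conj_ofReal]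
        field_simp
    · simp [hij]
  have hbessel : ∀ z : EuclideanSpace ℂ ι, ∑ i, ‖inner ℂ (u i) z‖ ^ 2 ≤ ‖z‖ ^ 2 := by
    intro z
    have ho : Orthonormal ℂ (fun i : {i : Fin (Fintype.card ι) // T.singularValues i ≠ 0} => u i.1) := by
      rw [orthonormal_iff_ite]
      rintro ⟨i, hi⟩ ⟨j, hj⟩
      simp only [huu, hi, if_false, Subtype.mk.injEq]
    have h := ho.sum_inner_products_le (x := z) (s := Finset.univ)
    refine le_trans (le_of_eq ?_) h
    have e : ∀ i, ‖inner ℂ (u i) z‖ ^ 2 =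
        if T.singularValues i ≠ 0 then ‖inner ℂ (u i) z‖ ^ 2 else 0 := by
      intro i
      by_cases h0 : T.singularValues i = 0
      · simp [hu, h0]
      · simp [h0]
    rw [Finset.sum_congr rfl fun i _ => e i, ← Finset.sum_filter]
    exact (Finset.sum_subtype _ (by simp) _)
  refine ⟨Matrix.of fun p q => ∑ i, (b i) p * star ((u i) q), fun z => ?_, ?_⟩
  · set Z : EuclideanSpace ℂ ι := WithLp.toLp 2 z with hZ
    have hRz : ∀ p, ((Matrix.of fun p q => ∑ i, (b i) p * star ((u i) q)) *ᵥ z) p =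
        (∑ i, (inner ℂ (u i) Z) • b i) p := by
      intro p
      simp only [Matrix.mulVec, dotProduct, Matrix.of_apply, Finset.sum_mul]
      rw [Finset.sum_comm]
      simp only [WithLp.ofLp_sum, Finset.sum_apply, PiLp.smul_apply, smul_eq_mul,
        PiLp.inner_apply, RCLike.inner_apply, Finset.sum_mul, hZ]
      refine Finset.sum_congr rfl fun i _ => Finset.sum_congr rfl fun q _ => ?_
      simp only [starRingEnd_apply]
      ring
    simp only [hRz]
    rw [← EuclideanSpace.norm_sq_eq]
    have hz : ∑ p, ‖z p‖ ^ 2 = ‖Z‖ ^ 2 := by rw [EuclideanSpace.norm_sq_eq]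
    rw [hz, ← b.sum_sq_norm_inner_right]
    refine le_trans (le_of_eq ?_) (hbessel Z)
    refine Finset.sum_congr rfl fun i _ => ?_
    congr 2
    rw [inner_sum]
    simp [inner_smul_right, orthonormal_iff_ite.mp b.orthonormal]
  · have h1 : (A * Matrix.of fun p q => ∑ i, (b i) p * star ((u i) q)).trace =
        ∑ i, inner ℂ (u i) (T (b i)) := by
      simp only [Matrix.trace, Matrix.diag, Matrix.mul_apply, Matrix.of_apply, Finset.mul_sum]
      rw [Finset.sum_congr rfl fun q _ => Finset.sum_comm, Finset.sum_comm]
      refine Finset.sum_congr rfl fun i _ => ?_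
      simp only [PiLp.inner_apply, RCLike.inner_apply, hT, Matrix.toLpLin_apply, Matrix.mulVec,
        dotProduct, Finset.sum_mul]
      refine Finset.sum_congr rfl fun q _ => Finset.sum_congr rfl fun p _ => ?_
      simp only [starRingEnd_apply]
      ring
    rw [h1, traceNorm_eq_sum_fin]
    push_cast
    refine Finset.sum_congr rfl fun i _ => ?_
    simp only [hu, inner_smul_left, hb, if_true, map_inv₀, Complex.conj_ofReal, ← hT]
    by_cases h0 : (T.singularValues i : ℂ) = 0
    · simp [h0]
    · field_simp

/-- A decomposition of a matrix into rank-one matrices that is optimal for the trace norm. -/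
lemma exists_sum_vecMulVec (X : Matrix ι ι ℂ) :
    ∃ x y : Fin (Fintype.card ι) → ι → ℂ, X = ∑ k, Matrix.vecMulVec (x k) (star (y k)) ∧
      traceNorm X = ∑ k, √(∑ p, ‖x k p‖ ^ 2) * √(∑ p, ‖y k p‖ ^ 2) := by
  obtain ⟨b, hb⟩ := exists_singular_basis X
  refine ⟨fun k => (Matrix.toEuclideanLin X (b k)).ofLp, fun k => (b k).ofLp, ?_, ?_⟩
  · have hpt : ∀ p r : ι, ∑ k, (b k) p * star ((b k) r) = if p = r then 1 else 0 := by
      intro p r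
      have h := congrArg (fun v : EuclideanSpace ℂ ι => v p)
        (b.sum_repr' (EuclideanSpace.single r (1 : ℂ)))
      simp only [WithLp.ofLp_sum, Finset.sum_apply, PiLp.smul_apply, smul_eq_mul,
        EuclideanSpace.inner_single_right, PiLp.single_apply, one_mul] at h
      rw [← h]
      refine Finset.sum_congr rfl fun k _ => ?_
      rw [mul_comm, starRingEnd_apply]
    ext q r
    simp only [Matrix.sum_apply, Matrix.vecMulVec_apply, Pi.star_apply, Matrix.toLpLin_apply,
      Matrix.mulVec, dotProduct, Finset.sum_mul]
    rw [Finset.sum_comm]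
    have : ∀ p, ∑ k, X q p * (b k) p * star ((b k) r) = X q p * if p = r then 1 else 0 := by
      intro p
      rw [← hpt p r, Finset.mul_sum]
      exact Finset.sum_congr rfl fun k _ => by ring
    simp only [this]
    simp
  · rw [traceNorm_eq_sum_fin]
    refine Finset.sum_congr rfl fun k _ => ?_
    rw [← EuclideanSpace.norm_eq, ← EuclideanSpace.norm_eq, b.norm_eq_one, mul_one]
    exact (norm_toEuclideanLin_of_singular_basis (by rw [hb k k, if_pos rfl])).symm

end TraceNorm

section Diamond

variable {dIn dOut : ℕ}

/-- The squared Hilbert–Schmidt norm of the Choi matrix of a superoperator. -/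
noncomputable def choiNormSq (L : Superoperator dIn dOut) : ℝ :=
  ∑ a, ∑ b, ∑ x, ∑ y, ‖L (Matrix.single a b 1) x y‖ ^ 2

lemma choiNormSq_nonneg (L : Superoperator dIn dOut) : 0 ≤ choiNormSq L := by
  unfold choiNormSq; positivity

lemma superoperator_apply_eq_sum (L : Superoperator dIn dOut) (Y : Matrix (Fin dIn) (Fin dIn) ℂ)
    (x y : Fin dOut) : L Y x y = ∑ a, ∑ b, Y a b * L (Matrix.single a b 1) x y := by
  conv_lhs => rw [Matrix.matrix_eq_sum_single Y]
  simp only [map_sum, Matrix.sum_apply]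
  refine Finset.sum_congr rfl fun a _ => Finset.sum_congr rfl fun b _ => ?_
  have : Matrix.single a b (Y a b) = Y a b • Matrix.single a b (1 : ℂ) := by simp
  rw [this, map_smul, Matrix.smul_apply, smul_eq_mul]

lemma norm_sum_mul_sq_le {κ : Type} (S : Finset κ) (f g : κ → ℂ) :
    ‖∑ i ∈ S, f i * g i‖ ^ 2 ≤ (∑ i ∈ S, ‖f i‖ ^ 2) * ∑ i ∈ S, ‖g i‖ ^ 2 := by
  have h : ‖∑ i ∈ S, f i * g i‖ ≤ ∑ i ∈ S, ‖f i‖ * ‖g i‖ :=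
    (norm_sum_le _ _).trans (le_of_eq (Finset.sum_congr rfl fun i _ => norm_mul _ _))
  exact (pow_le_pow_left₀ (norm_nonneg _) h 2).trans (Finset.sum_mul_sq_le_sq_mul_sq _ _ _)

/-- On a rank-one input `|x⟩⟨y|`, the extension of `L` is the Choi matrix multiplied by the matrices
of `x` and of `y`. Tested against a contraction, it has Hilbert–Schmidt size at most
`√dOut ‖x‖ ‖y‖` times that of the Choi matrix. -/
lemma norm_trace_tensorId_vecMulVec_le (L : Superoperator dIn dOut) (x y : Fin dIn × Fin dIn → ℂ)
    {R : Matrix (Fin dOut × Fin dIn) (Fin dOut × Fin dIn) ℂ}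
    (hR : ∀ z : Fin dOut × Fin dIn → ℂ, ∑ p, ‖(R *ᵥ z) p‖ ^ 2 ≤ ∑ p, ‖z p‖ ^ 2) :
    ‖(L.tensorId dIn (Matrix.vecMulVec x (star y)) * R).trace‖ ≤
      √dOut * √(choiNormSq L) * (√(∑ p, ‖x p‖ ^ 2) * √(∑ p, ‖y p‖ ^ 2)) := by
  set G : Fin dIn × Fin dIn × Fin dOut × Fin dOut → ℂ := fun t =>
    ∑ i, ∑ j, x (t.1, i) * star (y (t.2.1, j)) * R (t.2.2.2, j) (t.2.2.1, i) with hG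
  have htr : (L.tensorId dIn (Matrix.vecMulVec x (star y)) * R).trace =
      ∑ t : Fin dIn × Fin dIn × Fin dOut × Fin dOut,
        L (Matrix.single t.1 t.2.1 1) t.2.2.1 t.2.2.2 * G t := by
    have h1 : ∀ p q, L.tensorId dIn (Matrix.vecMulVec x (star y)) p q =
        ∑ a, ∑ b, x (a, p.2) * star (y (b, q.2)) * L (Matrix.single a b 1) p.1 q.1 := by
      intro p q
      exact superoperator_apply_eq_sum L _ _ _
    simp only [Matrix.trace, Matrix.diag, Matrix.mul_apply, h1, Fintype.sum_prod_type, hG,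
      Finset.mul_sum, Finset.sum_mul]
    have hcomm : ∀ F : Fin dOut → Fin dIn → Fin dOut → Fin dIn → Fin dIn → Fin dIn → ℂ,
        ∑ o, ∑ i, ∑ o', ∑ j, ∑ a, ∑ b, F o i o' j a b =
          ∑ a, ∑ b, ∑ o, ∑ o', ∑ i, ∑ j, F o i o' j a b := by
      intro F
      calc _ = ∑ o, ∑ o', ∑ i, ∑ j, ∑ a, ∑ b, F o i o' j a b :=
            Finset.sum_congr rfl fun o _ => Finset.sum_comm
        _ = ∑ t : Fin dOut × Fin dOut × Fin dIn × Fin dIn, ∑ s : Fin dIn × Fin dIn,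
              F t.1 t.2.2.1 t.2.1 t.2.2.2 s.1 s.2 := by simp only [Fintype.sum_prod_type]
        _ = ∑ s : Fin dIn × Fin dIn, ∑ t : Fin dOut × Fin dOut × Fin dIn × Fin dIn,
              F t.1 t.2.2.1 t.2.1 t.2.2.2 s.1 s.2 := Finset.sum_comm
        _ = _ := by simp only [Fintype.sum_prod_type]
    rw [hcomm]
    refine Finset.sum_congr rfl fun a _ => Finset.sum_congr rfl fun b _ =>
      Finset.sum_congr rfl fun o _ => Finset.sum_congr rfl fun o' _ =>
      Finset.sum_congr rfl fun i _ => Finset.sum_congr rfl fun j _ => ?_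
    ring
  have hJ : ∑ t : Fin dIn × Fin dIn × Fin dOut × Fin dOut,
      ‖L (Matrix.single t.1 t.2.1 1) t.2.2.1 t.2.2.2‖ ^ 2 = choiNormSq L := by
    simp only [Fintype.sum_prod_type, choiNormSq]
  have hGle : ∑ t, ‖G t‖ ^ 2 ≤ dOut * ((∑ p, ‖x p‖ ^ 2) * ∑ p, ‖y p‖ ^ 2) := by
    have hao : ∀ (a : Fin dIn) (o : Fin dOut), ∑ b, ∑ o', ‖G (a, b, o, o')‖ ^ 2 ≤
        (∑ i, ‖x (a, i)‖ ^ 2) * ∑ p, ‖y p‖ ^ 2 := by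
      intro a o
      set z : Fin dOut × Fin dIn → ℂ := fun r => if r.1 = o then x (a, r.2) else 0 with hz
      have hRz : ∀ o' j, (R *ᵥ z) (o', j) = ∑ i, R (o', j) (o, i) * x (a, i) := by
        intro o' j
        simp only [Matrix.mulVec, dotProduct, Fintype.sum_prod_type, hz]
        rw [Finset.sum_comm]
        simp
      have hzn : ∑ p, ‖z p‖ ^ 2 = ∑ i, ‖x (a, i)‖ ^ 2 := by
        simp only [Fintype.sum_prod_type, hz]
        rw [Finset.sum_comm]
        refine Finset.sum_congr rfl fun i _ => ?_
        rw [Finset.sum_eq_single o]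
        · simp
        · intro c _ hc; simp [hc]
        · simp
      have hGe : ∀ b o', G (a, b, o, o') = ∑ j, star (y (b, j)) * (R *ᵥ z) (o', j) := by
        intro b o'
        simp only [hG, hRz, Finset.mul_sum]
        rw [Finset.sum_comm]
        refine Finset.sum_congr rfl fun j _ => Finset.sum_congr rfl fun i _ => ?_
        ring
      calc ∑ b, ∑ o', ‖G (a, b, o, o')‖ ^ 2
          ≤ ∑ b, ∑ o', (∑ j, ‖y (b, j)‖ ^ 2) * ∑ j, ‖(R *ᵥ z) (o', j)‖ ^ 2 := by
            refine Finset.sum_le_sum fun b _ => Finset.sum_le_sum fun o' _ => ?_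
            rw [hGe]
            refine (norm_sum_mul_sq_le _ _ _).trans (le_of_eq ?_)
            simp only [norm_star]
        _ = (∑ p, ‖y p‖ ^ 2) * ∑ p, ‖(R *ᵥ z) p‖ ^ 2 := by
            rw [Fintype.sum_prod_type (f := fun p => ‖y p‖ ^ 2), Finset.sum_mul]
            simp only [Fintype.sum_prod_type, Finset.mul_sum]
        _ ≤ (∑ p, ‖y p‖ ^ 2) * ∑ i, ‖x (a, i)‖ ^ 2 := by
            rw [← hzn]
            exact mul_le_mul_of_nonneg_left (hR z) (by positivity)
        _ = _ := mul_comm _ _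
    calc ∑ t, ‖G t‖ ^ 2 = ∑ a, ∑ o, ∑ b, ∑ o', ‖G (a, b, o, o')‖ ^ 2 := by
          simp only [Fintype.sum_prod_type]
          exact Finset.sum_congr rfl fun a _ => Finset.sum_comm
      _ ≤ ∑ a, ∑ _o : Fin dOut, (∑ i, ‖x (a, i)‖ ^ 2) * ∑ p, ‖y p‖ ^ 2 :=
          Finset.sum_le_sum fun a _ => Finset.sum_le_sum fun o _ => hao a o
      _ = _ := by
          simp only [Finset.sum_const, Finset.card_univ, Fintype.card_fin, nsmul_eq_mul]
          rw [← Finset.mul_sum, ← Finset.sum_mul]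
          simp only [Fintype.sum_prod_type]
  rw [htr]
  have hcs := norm_sum_mul_sq_le Finset.univ
    (fun t : Fin dIn × Fin dIn × Fin dOut × Fin dOut =>
      L (Matrix.single t.1 t.2.1 1) t.2.2.1 t.2.2.2) G
  rw [hJ] at hcs
  have hc0 := choiNormSq_nonneg L
  refine le_of_sq_le_sq ?_ (by positivity)
  rw [mul_pow, mul_pow, mul_pow, Real.sq_sqrt (by positivity), Real.sq_sqrt hc0,
    Real.sq_sqrt (by positivity), Real.sq_sqrt (by positivity)]
  refine hcs.trans ((mul_le_mul_of_nonneg_left hGle hc0).trans (le_of_eq ?_))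
  ring

lemma traceNorm_tensorId_le (L : Superoperator dIn dOut)
    (X : Matrix (Fin dIn × Fin dIn) (Fin dIn × Fin dIn) ℂ) :
    traceNorm (L.tensorId dIn X) ≤ √dOut * √(choiNormSq L) * traceNorm X := by
  obtain ⟨R, hR, htr⟩ := exists_contraction_traceNorm_eq (L.tensorId dIn X)
  obtain ⟨x, y, hX, hn⟩ := exists_sum_vecMulVec X
  have hre : traceNorm (L.tensorId dIn X) ≤ ‖(L.tensorId dIn X * R).trace‖ := by
    rw [← htr, Complex.norm_real]
    exact Real.le_norm_self _
  refine hre.trans ?_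
  have hsum : (L.tensorId dIn X * R).trace =
      ∑ k, (L.tensorId dIn (Matrix.vecMulVec (x k) (star (y k))) * R).trace := by
    conv_lhs => rw [hX]
    rw [map_sum, Finset.sum_mul, Matrix.trace_sum]
  rw [hsum, hn, Finset.mul_sum]
  exact (norm_sum_le _ _).trans
    (Finset.sum_le_sum fun k _ => norm_trace_tensorId_vecMulVec_le L (x k) (y k) hR)

lemma diamondNorm_le (L : Superoperator dIn dOut) :
    diamondNorm L ≤ √dOut * √(choiNormSq L) := by
  refine Real.sSup_le ?_ (by positivity)
  rintro _ ⟨X, hX, rfl⟩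
  exact (traceNorm_tensorId_le L X).trans (mul_le_of_le_one_right (by positivity) hX)

end Diamond

/-! ### Quadratic forms at random phase vectors -/

section Phases

variable {κ : Type} [DecidableEq κ]

/-- The vector of phases `(±1 ± i) / √2` with the given signs. -/
noncomputable def phaseVec {κ : Type} (s : κ × Bool → Bool) (a : κ) : ℂ :=
  ((boolSign (s (a, false)) : ℂ) + boolSign (s (a, true)) * Complex.I) / (√2 : ℝ)

lemma star_phaseVec_mul {κ : Type} (s : κ × Bool → Bool) (a : κ) :
    star (phaseVec s a) * phaseVec s a = 1 := by
  have h2 : ((√2 : ℝ) : ℂ) * (√2 : ℝ) = 2 := by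
    rw [← Complex.ofReal_mul, Real.mul_self_sqrt (by norm_num)]; norm_num
  have h2' : ((√2 : ℝ) : ℂ) ≠ 0 := fun h => by rw [h] at h2; norm_num at h2
  have e1 : (boolSign (s (a, false)) : ℂ) * boolSign (s (a, false)) = 1 := by
    exact_mod_cast boolSign_mul_self _
  have e2 : (boolSign (s (a, true)) : ℂ) * boolSign (s (a, true)) = 1 := by
    exact_mod_cast boolSign_mul_self _
  have hI := Complex.I_mul_I
  simp only [phaseVec, Complex.star_def, map_div₀, map_add, map_mul, Complex.conj_ofReal,
    Complex.conj_I]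
  rw [div_mul_div_comm, h2, div_eq_one_iff_eq (by norm_num)]
  linear_combination e1 + e2 - hI * (boolSign (s (a, true)) : ℂ) * boolSign (s (a, true))

/-- The bijection of signs that multiplies the phase of coordinate `c` by `i`. -/
def rotateAt (c : κ) : (κ × Bool → Bool) ≃ (κ × Bool → Bool) where
  toFun s p := if p.1 = c then (if p.2 then s (c, false) else !s (c, true)) else s p
  invFun s p := if p.1 = c then (if p.2 then !s (c, false) else s (c, true)) else s p
  left_inv s := by
    funext ⟨a, e⟩
    by_cases h : a = c
    · subst h; cases e <;> simp
    · simp [h]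
  right_inv s := by
    funext ⟨a, e⟩
    by_cases h : a = c
    · subst h; cases e <;> simp
    · simp [h]

lemma phaseVec_rotateAt (c : κ) (s : κ × Bool → Bool) (a : κ) :
    phaseVec (rotateAt c s) a = if a = c then Complex.I * phaseVec s a else phaseVec s a := by
  by_cases h : a = c
  · subst h
    have e1 : rotateAt a s (a, false) = !s (a, true) := by simp [rotateAt]
    have e2 : rotateAt a s (a, true) = s (a, false) := by simp [rotateAt]
    have hI := Complex.I_mul_I
    rw [if_pos rfl, phaseVec, e1, e2, boolSign_not, phaseVec, mul_div_assoc']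
    congr 1
    push_cast
    linear_combination -(boolSign (s (a, true)) : ℂ) * hI
  · simp [phaseVec, rotateAt, h]

variable [Fintype κ]

lemma expect_eq_zero_of_rotateAt {F : (κ × Bool → Bool) → ℂ} (c : κ) {z : ℂ} (hz : z ≠ 1)
    (hF : ∀ s, F (rotateAt c s) = z * F s) : 𝔼 s, F s = 0 := by
  have h : 𝔼 s, z * F s = 𝔼 s, F s :=
    Fintype.expect_equiv (rotateAt c) _ _ fun s => (hF s).symm
  rw [← Finset.mul_expect] at h
  have : (z - 1) * 𝔼 s, F s = 0 := by linear_combination h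
  exact (mul_eq_zero.mp this).resolve_left (sub_ne_zero.mpr hz)

/-- Distinct products `ū_a u_b` of random phases are orthogonal, except that all products with
`a = b` coincide. -/
lemma expect_phase_mul_eq_zero {p q : κ × κ} (hp : p.1 ≠ p.2) (hpq : p ≠ q) :
    𝔼 s, (star (phaseVec s p.1) * phaseVec s p.2) *
      star (star (phaseVec s q.1) * phaseVec s q.2) = 0 := by
  have hI := Complex.I_mul_I
  obtain ⟨a, b⟩ := p
  obtain ⟨a', b'⟩ := q
  simp only at hp
  by_cases ha : a = a'
  · subst ha
    have hb : b ≠ b' := fun h => hpq (by rw [h])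
    refine expect_eq_zero_of_rotateAt b (z := Complex.I)
      (fun h => by simpa using congrArg Complex.re h) fun s => ?_
    simp only [phaseVec_rotateAt, if_true, hp, hb.symm, if_false]
    ring
  · by_cases hb : b' = a
    · subst hb
      refine expect_eq_zero_of_rotateAt b' (z := -1) (by norm_num) fun s => ?_
      simp only [phaseVec_rotateAt, if_true, hp.symm, Ne.symm ha, if_false, star_mul',
        Complex.star_def, Complex.conj_I, Complex.conj_conj]
      linear_combination (starRingEnd ℂ (phaseVec s b') * phaseVec s b *
        (phaseVec s a' * starRingEnd ℂ (phaseVec s b'))) * hI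
    · refine expect_eq_zero_of_rotateAt a (z := -Complex.I)
        (fun h => by simpa using congrArg Complex.re h) fun s => ?_
      simp only [phaseVec_rotateAt, if_true, hp.symm, Ne.symm ha, hb, if_false, star_mul',
        Complex.star_def, Complex.conj_I]
      ring

/-- The squared Hilbert–Schmidt norm of the off-diagonal part of a matrix. -/
noncomputable def offDiagNormSq (β : Matrix κ κ ℂ) : ℝ :=
  ∑ p : κ × κ, if p.1 = p.2 then 0 else ‖β p.1 p.2‖ ^ 2

/-- The quadratic form `⟨v, β v⟩`. -/
def quadForm (β : Matrix κ κ ℂ) (v : κ → ℂ) : ℂ := ∑ x, ∑ y, star (v x) * β x y * v y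

/-- The second moment of a quadratic form at a random phase vector. -/
lemma expect_norm_sq_quadForm_phaseVec (β : Matrix κ κ ℂ) :
    𝔼 s, ‖quadForm β (phaseVec s)‖ ^ 2 = ‖β.trace‖ ^ 2 + offDiagNormSq β := by
  set γ : κ × κ → ℂ := fun p => if p.1 = p.2 then 0 else β p.1 p.2 with hγ
  set μ : κ × κ → (κ × Bool → Bool) → ℂ := fun p s => star (phaseVec s p.1) * phaseVec s p.2
    with hμ
  have hQ : ∀ s, quadForm β (phaseVec s) = β.trace + ∑ p, γ p * μ p s := by
    intro s
    have e : ∀ x y, star (phaseVec s x) * β x y * phaseVec s y =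
        (if x = y then β x x else 0) + γ (x, y) * μ (x, y) s := by
      intro x y
      by_cases h : x = y
      · subst h
        simp only [hγ, if_true, zero_mul, add_zero]
        linear_combination β x x * star_phaseVec_mul s x
      · simp only [hγ, hμ, h, if_false]
        ring
    simp only [quadForm, e, Finset.sum_add_distrib, Finset.sum_ite_eq, Finset.mem_univ, if_true,
      Fintype.sum_prod_type, Matrix.trace, Matrix.diag]
  have hμμ : ∀ p s, μ p s * star (μ p s) = 1 := by
    intro p s
    simp only [hμ, star_mul', star_star]
    linear_combination (star (phaseVec s p.2) * phaseVec s p.2) * star_phaseVec_mul s p.1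
      + star_phaseVec_mul s p.2
  have hzero : ∀ p q, γ p * star (γ q) * 𝔼 s, μ p s * star (μ q s) =
      if p = q then γ p * star (γ p) else 0 := by
    intro p q
    by_cases hpq : p = q
    · subst hpq
      simp only [hμμ, if_true, Fintype.expect_const, mul_one]
    · rw [if_neg hpq]
      by_cases h : p.1 = p.2
      · simp [hγ, h]
      · rw [expect_phase_mul_eq_zero h hpq, mul_zero]
  have hlin : 𝔼 s, ∑ p, γ p * μ p s = 0 := by
    rw [Finset.expect_sum_comm]
    refine Finset.sum_eq_zero fun p _ => ?_
    rw [← Finset.mul_expect]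
    by_cases h : p.1 = p.2
    · simp [hγ, h]
    · have h0 := expect_phase_mul_eq_zero (q := (p.1, p.1)) h
        (fun hh => h (congrArg Prod.snd hh).symm)
      have e : ∀ s, star (star (phaseVec s p.1) * phaseVec s p.1) = 1 := fun s => by
        rw [star_phaseVec_mul, star_one]
      simp only [e, mul_one] at h0
      rw [h0, mul_zero]
  have hquad : 𝔼 s, (∑ p, γ p * μ p s) * star (∑ p, γ p * μ p s) = ∑ p, γ p * star (γ p) := by
    have e : ∀ s, (∑ p, γ p * μ p s) * star (∑ p, γ p * μ p s) =
        ∑ p, ∑ q, γ p * star (γ q) * (μ p s * star (μ q s)) := by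
      intro s
      rw [star_sum, Finset.sum_mul_sum]
      refine Finset.sum_congr rfl fun p _ => Finset.sum_congr rfl fun q _ => ?_
      rw [star_mul']; ring
    simp only [e, Finset.expect_sum_comm, ← Finset.mul_expect, hzero]
    simp
  have hC : 𝔼 s, quadForm β (phaseVec s) * star (quadForm β (phaseVec s)) =
      β.trace * star β.trace + ∑ p, γ p * star (γ p) := by
    have e : ∀ s, quadForm β (phaseVec s) * star (quadForm β (phaseVec s)) =
        β.trace * star β.trace + β.trace * star (∑ p, γ p * μ p s)
        + star β.trace * (∑ p, γ p * μ p s) +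
        (∑ p, γ p * μ p s) * star (∑ p, γ p * μ p s) := by
      intro s
      rw [hQ, star_add]; ring
    simp only [e, Finset.expect_add_distrib, Fintype.expect_const, ← Finset.mul_expect]
    have hs : 𝔼 s, star (∑ p, γ p * μ p s) = star (𝔼 s, ∑ p, γ p * μ p s) := by
      rw [Fintype.expect_eq_sum_div_card, Fintype.expect_eq_sum_div_card, ← star_sum]
      simp
    rw [hs, hlin, hquad]
    simp
  have hn : ∀ z : ℂ, z * star z = ((‖z‖ ^ 2 : ℝ) : ℂ) := fun z => by
    rw [Complex.star_def, Complex.mul_conj, Complex.normSq_eq_norm_sq]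
  simp only [hn] at hC
  have hγn : ∀ p, ‖γ p‖ ^ 2 = if p.1 = p.2 then 0 else ‖β p.1 p.2‖ ^ 2 := by
    intro p
    by_cases h : p.1 = p.2 <;> simp [hγ, h]
  apply Complex.ofReal_injective
  rw [offDiagNormSq, ← Finset.sum_congr rfl fun p _ => hγn p]
  push_cast at hC ⊢
  rw [← hC]

end Phases

section Flat

variable {d : ℕ}

/-- The squared Hilbert–Schmidt norm of a matrix. -/
noncomputable def hsNormSq (β : Matrix (Fin d) (Fin d) ℂ) : ℝ := ∑ x, ∑ y, ‖β x y‖ ^ 2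

lemma hsNormSq_eq_trace (β : Matrix (Fin d) (Fin d) ℂ) : (hsNormSq β : ℂ) = (βᴴ * β).trace := by
  simp only [hsNormSq, Matrix.trace, Matrix.diag, Matrix.mul_apply, Matrix.conjTranspose_apply]
  push_cast
  rw [Finset.sum_comm]
  refine Finset.sum_congr rfl fun x _ => Finset.sum_congr rfl fun y _ => ?_
  rw [Complex.star_def, mul_comm, Complex.mul_conj, Complex.normSq_eq_norm_sq]
  push_cast; rfl

lemma hsNormSq_unitary_conj {V : Matrix (Fin d) (Fin d) ℂ} (hV : Vᴴ * V = 1)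
    (β : Matrix (Fin d) (Fin d) ℂ) : hsNormSq (Vᴴ * β * V) = hsNormSq β := by
  have hV' : V * Vᴴ = 1 := mul_eq_one_comm.mp hV
  apply Complex.ofReal_injective
  rw [hsNormSq_eq_trace, hsNormSq_eq_trace]
  simp only [Matrix.conjTranspose_mul, Matrix.conjTranspose_conjTranspose]
  calc (Vᴴ * (βᴴ * V) * (Vᴴ * β * V)).trace
      = (Vᴴ * (βᴴ * (V * Vᴴ) * β * V)).trace := by simp only [Matrix.mul_assoc]
    _ = _ := by
      rw [hV', Matrix.trace_mul_comm, Matrix.mul_one, Matrix.mul_assoc, hV', Matrix.mul_one]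

lemma hsNormSq_eq_diag_add (β : Matrix (Fin d) (Fin d) ℂ) :
    hsNormSq β = ∑ x, ‖β x x‖ ^ 2 + offDiagNormSq β := by
  have e : ∀ x y, ‖β x y‖ ^ 2 = (if x = y then ‖β x x‖ ^ 2 else 0) +
      if x = y then 0 else ‖β x y‖ ^ 2 := by
    intro x y
    by_cases h : x = y
    · subst h; simp
    · simp [h]
  rw [hsNormSq, offDiagNormSq, Fintype.sum_prod_type]
  rw [← Finset.sum_add_distrib]
  refine Finset.sum_congr rfl fun x _ => ?_
  rw [Finset.sum_congr rfl fun y _ => e x y, Finset.sum_add_distrib, Finset.sum_ite_eq,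
    if_pos (Finset.mem_univ x)]

lemma offDiagNormSq_nonneg (β : Matrix (Fin d) (Fin d) ℂ) : 0 ≤ offDiagNormSq β :=
  Finset.sum_nonneg fun p _ => by split_ifs <;> positivity

/-- A matrix is flat unitary if it is unitary and all its entries have the same modulus. -/
structure IsFlatUnitary (F : Matrix (Fin d) (Fin d) ℂ) : Prop where
  unitary : Fᴴ * F = 1
  flat : ∀ x a, star (F x a) * F x a = 1 / d

/-- The discrete Fourier transform is flat unitary. -/
lemma exists_isFlatUnitary (hd : 1 ≤ d) : ∃ F : Matrix (Fin d) (Fin d) ℂ, IsFlatUnitary F := by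
  have hd0 : d ≠ 0 := by omega
  have hdC : (d : ℂ) ≠ 0 := by exact_mod_cast hd0
  set ω := Complex.exp (2 * Real.pi * Complex.I / d)
  have hω : IsPrimitiveRoot ω d := Complex.isPrimitiveRoot_exp d hd0
  have hn : ‖ω‖ = 1 := hω.norm'_eq_one hd0
  have hsω : star ω * ω = 1 := by
    rw [Complex.star_def, mul_comm, Complex.mul_conj, Complex.normSq_eq_norm_sq, hn]; norm_num
  have hsd : ((√d : ℝ) : ℂ) * (√d : ℝ) = d := by
    rw [← Complex.ofReal_mul, Real.mul_self_sqrt (Nat.cast_nonneg d)]; norm_num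
  have hsa : ∀ a : ℕ, star (ω ^ a) * ω ^ a = 1 := fun a => by
    rw [star_pow, ← mul_pow, hsω, one_pow]
  have key : ∀ (x : ℕ) (a b : ℕ), star ((ω ^ a) ^ x / (√d : ℝ)) * ((ω ^ b) ^ x / (√d : ℝ)) =
      (star (ω ^ a) * ω ^ b) ^ x / d := by
    intro x a b
    simp only [Complex.star_def, map_div₀, map_pow, Complex.conj_ofReal]
    rw [div_mul_div_comm, hsd, ← mul_pow]
  refine ⟨Matrix.of fun x a => (ω ^ (a : ℕ)) ^ (x : ℕ) / (√d : ℝ), ?_, fun x a => ?_⟩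
  · ext a b
    simp only [Matrix.mul_apply, Matrix.conjTranspose_apply, Matrix.of_apply, key]
    rw [← Finset.sum_div, Fin.sum_univ_eq_sum_range (fun x => (star (ω ^ (a : ℕ)) * ω ^ (b : ℕ)) ^ x)]
    by_cases hab : a = b
    · subst hab
      simp only [hsa, one_pow, Finset.sum_const, Finset.card_range, nsmul_eq_mul, mul_one,
        Matrix.one_apply_eq]
      exact div_self hdC
    · have hne : star (ω ^ (a : ℕ)) * ω ^ (b : ℕ) ≠ 1 := by
        intro h
        have h2 : ω ^ (a : ℕ) = ω ^ (b : ℕ) := by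
          linear_combination ω ^ (b : ℕ) * hsa a - ω ^ (a : ℕ) * h
        exact hab (Fin.ext (hω.pow_inj a.2 b.2 h2))
      have hone : (star (ω ^ (a : ℕ)) * ω ^ (b : ℕ)) ^ d = 1 := by
        have h1 : ∀ c : ℕ, (ω ^ c) ^ d = 1 := fun c => by
          rw [← pow_mul, mul_comm, pow_mul, hω.pow_eq_one, one_pow]
        rw [mul_pow, ← star_pow, h1, h1, star_one, mul_one]
      rw [geom_sum_eq hne, hone]
      simp [hab]
  · simp only [Matrix.of_apply, key, hsa, one_pow]

/-- In a basis unbiased with respect to the standard one, the diagonal of a matrix is controlled by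
its trace and its off-diagonal part. -/
lemma IsFlatUnitary.sum_diag_le {F : Matrix (Fin d) (Fin d) ℂ} (hF : IsFlatUnitary F)
    (β : Matrix (Fin d) (Fin d) ℂ) :
    ∑ a, ‖(Fᴴ * β * F) a a‖ ^ 2 ≤ ‖β.trace‖ ^ 2 + offDiagNormSq β := by
  rcases Nat.eq_zero_or_pos d with rfl | hd
  · simp only [Finset.univ_eq_empty, Finset.sum_empty]
    have := offDiagNormSq_nonneg β
    positivity
  have hd1 : (1 : ℝ) ≤ d := by exact_mod_cast hd
  set β₀ : Matrix (Fin d) (Fin d) ℂ := Matrix.of fun x y => if x = y then 0 else β x y with hβ₀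
  have hsplit : β = Matrix.diagonal (fun x => β x x) + β₀ := by
    ext x y
    by_cases h : x = y
    · subst h; simp [hβ₀]
    · simp [hβ₀, h]
  have hdiag : ∀ a, (Fᴴ * Matrix.diagonal (fun x => β x x) * F) a a = β.trace / d := by
    intro a
    rw [Matrix.mul_apply]
    simp only [Matrix.mul_diagonal, Matrix.conjTranspose_apply]
    have : ∀ x, star (F x a) * β x x * F x a = β x x * (1 / d) := fun x => by
      rw [← hF.flat x a]; ring
    simp only [this, ← Finset.sum_mul]
    rw [Matrix.trace, mul_one_div]; rfl
  set o : Fin d → ℂ := fun a => (Fᴴ * β₀ * F) a a with ho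
  have hent : ∀ a, (Fᴴ * β * F) a a = β.trace / d + o a := by
    intro a
    conv_lhs => rw [hsplit]
    rw [Matrix.mul_add, Matrix.add_mul, Matrix.add_apply, hdiag]
  have hsum : ∑ a, o a = 0 := by
    have : ∑ a, o a = (Fᴴ * β₀ * F).trace := rfl
    rw [this, Matrix.trace_mul_comm, ← Matrix.mul_assoc, mul_eq_one_comm.mp hF.unitary,
      Matrix.one_mul]
    simp [Matrix.trace, hβ₀]
  have hoff : ∑ a, ‖o a‖ ^ 2 ≤ offDiagNormSq β := by
    have h1 : ∑ a, ‖o a‖ ^ 2 ≤ hsNormSq (Fᴴ * β₀ * F) := by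
      rw [hsNormSq_eq_diag_add]
      linarith [offDiagNormSq_nonneg (Fᴴ * β₀ * F)]
    rw [hsNormSq_unitary_conj hF.unitary] at h1
    refine h1.trans (le_of_eq ?_)
    rw [hsNormSq, offDiagNormSq, Fintype.sum_prod_type]
    refine Finset.sum_congr rfl fun x _ => Finset.sum_congr rfl fun y _ => ?_
    by_cases h : x = y <;> simp [hβ₀, h]
  have hexp : ∀ a, ‖β.trace / d + o a‖ ^ 2 =
      ‖β.trace / d‖ ^ 2 + 2 * (star (β.trace / d) * o a).re + ‖o a‖ ^ 2 := by
    intro a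
    rw [← Complex.normSq_eq_norm_sq, ← Complex.normSq_eq_norm_sq, ← Complex.normSq_eq_norm_sq,
      Complex.normSq_add]
    have : ((β.trace / d) * (starRingEnd ℂ) (o a)).re = (star (β.trace / d) * o a).re := by
      rw [Complex.star_def, ← Complex.conj_re, map_mul, Complex.conj_conj]
    rw [this]; ring
  simp only [hent, hexp, Finset.sum_add_distrib, ← Finset.mul_sum]
  rw [← Complex.re_sum, ← Finset.mul_sum, hsum]
  have ht : ∑ _a : Fin d, ‖β.trace / d‖ ^ 2 ≤ ‖β.trace‖ ^ 2 := by
    rw [Finset.sum_const, Finset.card_univ, Fintype.card_fin, nsmul_eq_mul, norm_div, div_pow,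
      Complex.norm_natCast]
    rw [mul_div_assoc', div_le_iff₀ (by positivity)]
    have h2 : (d : ℝ) ≤ (d : ℝ) ^ 2 := by nlinarith
    nlinarith [mul_le_mul_of_nonneg_left h2 (sq_nonneg ‖β.trace‖)]
  simp only [mul_zero, Complex.zero_re]
  linarith

lemma quadForm_mulVec (β V : Matrix (Fin d) (Fin d) ℂ) (φ u : Fin d → ℂ) :
    quadForm β (V *ᵥ fun x => φ x * u x) =
      quadForm (Matrix.of fun x y => star (φ x) * (Vᴴ * β * V) x y * φ y) u := by
  have h : ∀ (γ : Matrix (Fin d) (Fin d) ℂ) v, quadForm γ v = star v ⬝ᵥ (γ *ᵥ v) := by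
    intro γ v
    simp only [quadForm, dotProduct, Matrix.mulVec, Finset.mul_sum, Pi.star_apply, mul_assoc]
  rw [h, Matrix.star_mulVec, ← Matrix.dotProduct_mulVec, Matrix.mulVec_mulVec, Matrix.mulVec_mulVec,
    ← h, quadForm, quadForm]
  refine Finset.sum_congr rfl fun x _ => Finset.sum_congr rfl fun y _ => ?_
  simp only [Matrix.of_apply, star_mul']
  ring

/-- The two bases, the standard one and one unbiased with respect to it, that together see every
component of a matrix. -/
def armBasis (F : Matrix (Fin d) (Fin d) ℂ) (b : Bool) : Matrix (Fin d) (Fin d) ℂ :=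
  if b then F else 1

lemma IsFlatUnitary.armBasis_unitary {F : Matrix (Fin d) (Fin d) ℂ} (hF : IsFlatUnitary F)
    (b : Bool) : (armBasis F b)ᴴ * armBasis F b = 1 := by
  cases b
  · simp [armBasis]
  · simpa [armBasis] using hF.unitary

/-- Random phases in two unbiased bases detect the full Hilbert–Schmidt norm of a quadratic form:
what is diagonal in one basis is off-diagonal in the other, apart from multiples of the identity,
which are seen through their trace. -/
lemma IsFlatUnitary.hsNormSq_le {F : Matrix (Fin d) (Fin d) ℂ} (hF : IsFlatUnitary F)
    (β : Matrix (Fin d) (Fin d) ℂ) {φ : Fin d → ℂ} {r : ℝ} (hφ : ∀ x, star (φ x) * φ x = r) :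
    r ^ 2 * hsNormSq β ≤
      ∑ b, 𝔼 s, ‖quadForm β (armBasis F b *ᵥ fun x => φ x * phaseVec s x)‖ ^ 2 := by
  have hφn : ∀ x, ‖φ x‖ ^ 2 = r := by
    intro x
    have := hφ x
    rw [Complex.star_def, mul_comm, Complex.mul_conj, Complex.normSq_eq_norm_sq] at this
    exact_mod_cast this
  have key : ∀ b, 𝔼 s, ‖quadForm β (armBasis F b *ᵥ fun x => φ x * phaseVec s x)‖ ^ 2 =
      r ^ 2 * (‖β.trace‖ ^ 2 + offDiagNormSq ((armBasis F b)ᴴ * β * armBasis F b)) := by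
    intro b
    simp only [quadForm_mulVec]
    rw [expect_norm_sq_quadForm_phaseVec]
    have htr : (Matrix.of fun x y => star (φ x) * ((armBasis F b)ᴴ * β * armBasis F b) x y *
        φ y).trace = r * β.trace := by
      have h1 : ((armBasis F b)ᴴ * β * armBasis F b).trace = β.trace := by
        rw [Matrix.trace_mul_comm, ← Matrix.mul_assoc,
          mul_eq_one_comm.mp (hF.armBasis_unitary b), Matrix.one_mul]
      rw [← h1]
      simp only [Matrix.trace, Matrix.diag, Matrix.of_apply, Finset.mul_sum]
      refine Finset.sum_congr rfl fun x _ => ?_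
      rw [← hφ x]; ring
    have hoff : offDiagNormSq (Matrix.of fun x y => star (φ x) *
        ((armBasis F b)ᴴ * β * armBasis F b) x y * φ y) =
        r ^ 2 * offDiagNormSq ((armBasis F b)ᴴ * β * armBasis F b) := by
      simp only [offDiagNormSq, Finset.mul_sum, Matrix.of_apply, norm_mul, norm_star, mul_pow, hφn]
      refine Finset.sum_congr rfl fun p _ => ?_
      split_ifs <;> ring
    rw [htr, hoff, norm_mul, mul_pow, Complex.norm_real, Real.norm_eq_abs, sq_abs]
    ring
  rw [Fintype.sum_bool, key, key, ← mul_add]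
  refine mul_le_mul_of_nonneg_left ?_ (sq_nonneg r)
  have h1 := hsNormSq_eq_diag_add (Fᴴ * β * F)
  rw [hsNormSq_unitary_conj hF.unitary] at h1
  have h2 := hF.sum_diag_le β
  simp only [armBasis, if_true, Bool.false_eq_true, if_false, Matrix.conjTranspose_one,
    Matrix.one_mul, Matrix.mul_one]
  nlinarith [sq_nonneg ‖β.trace‖]

end Flat

/-! ### Random product queries to a channel -/

section Settings

lemma quadForm_eq_dotProduct {d : ℕ} (β : Matrix (Fin d) (Fin d) ℂ) (v : Fin d → ℂ) :
    quadForm β v = star v ⬝ᵥ (β *ᵥ v) := by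
  simp only [quadForm, dotProduct, Matrix.mulVec, Finset.mul_sum, Pi.star_apply, mul_assoc]

lemma trace_vecMulVec_mul {d : ℕ} (β : Matrix (Fin d) (Fin d) ℂ) (v : Fin d → ℂ) :
    (Matrix.vecMulVec v (star v) * β).trace = quadForm β v := by
  simp only [Matrix.trace, Matrix.diag, Matrix.mul_apply, Matrix.vecMulVec_apply, quadForm,
    Pi.star_apply]
  rw [Finset.sum_comm]
  refine Finset.sum_congr rfl fun x _ => Finset.sum_congr rfl fun y _ => ?_
  ring

lemma IsChannel.posSemidef {dIn dOut : ℕ} {M : Superoperator dIn dOut} (hM : IsChannel M)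
    {ρ : Matrix (Fin dIn) (Fin dIn) ℂ} (hρ : ρ.PosSemidef) : (M ρ).PosSemidef := by
  have h := (hM.completelyPositive 1 (ρ.submatrix Prod.fst Prod.fst)
    (hρ.submatrix Prod.fst)).submatrix (fun x : Fin dOut => (x, (0 : Fin 1)))
  exact h

variable {dIn dOut : ℕ}

/-- A random input vector: coordinates of equal modulus and with random phases, in one of two bases. -/
noncomputable def inputVec (F : Matrix (Fin dIn) (Fin dIn) ℂ) (b : Bool)
    (s : Fin dIn × Bool → Bool) : Fin dIn → ℂ :=
  armBasis F b *ᵥ fun x => ((1 / √dIn : ℝ) : ℂ) * phaseVec s x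

/-- The vectors of a random measurement basis: the columns of `F` with randomly rephased rows, in
one of two bases. -/
noncomputable def measVec (F : Matrix (Fin dOut) (Fin dOut) ℂ) (b : Bool)
    (s : Fin dOut × Bool → Bool) (j : Fin dOut) : Fin dOut → ℂ :=
  armBasis F b *ᵥ fun x => F x j * phaseVec s x

lemma IsFlatUnitary.isPureState_inputVec (hd : 1 ≤ dIn) {F : Matrix (Fin dIn) (Fin dIn) ℂ}
    (hF : IsFlatUnitary F) (b : Bool) (s : Fin dIn × Bool → Bool) :
    IsPureState (Matrix.vecMulVec (inputVec F b s) (star (inputVec F b s))) := by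
  refine ⟨WithLp.toLp 2 (inputVec F b s), ?_, rfl⟩
  have hd0 : (0 : ℝ) < dIn := by exact_mod_cast hd
  have h1 : star (inputVec F b s) ⬝ᵥ inputVec F b s = 1 := by
    rw [inputVec, Matrix.star_mulVec, ← Matrix.dotProduct_mulVec, Matrix.mulVec_mulVec,
      hF.armBasis_unitary, Matrix.one_mulVec]
    simp only [dotProduct, Pi.star_apply, star_mul', Complex.star_def, Complex.conj_ofReal]
    have e : ∀ x, ((1 / √dIn : ℝ) : ℂ) * (starRingEnd ℂ) (phaseVec s x) *
        (((1 / √dIn : ℝ) : ℂ) * phaseVec s x) = ((1 / dIn : ℝ) : ℂ) := by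
      intro x
      have h2 : (1 / √dIn : ℝ) * (1 / √dIn) = 1 / dIn := by
        rw [div_mul_div_comm, Real.mul_self_sqrt hd0.le, one_mul]
      have h3 := star_phaseVec_mul s x
      rw [Complex.star_def] at h3
      rw [← h2]
      push_cast
      linear_combination (1 / (√dIn : ℂ) * (1 / (√dIn : ℂ))) * h3
    simp only [e]
    rw [Finset.sum_const, Finset.card_univ, Fintype.card_fin, nsmul_eq_mul]
    push_cast
    have : (dIn : ℂ) ≠ 0 := by exact_mod_cast hd0.ne'
    field_simp
  have h2 : (‖(WithLp.toLp 2 (inputVec F b s) : EuclideanSpace ℂ (Fin dIn))‖ : ℂ) ^ 2 = 1 := by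
    rw [← h1, ← Complex.ofReal_pow, EuclideanSpace.norm_sq_eq]
    simp only [dotProduct, Pi.star_apply]
    push_cast
    refine Finset.sum_congr rfl fun x _ => ?_
    rw [Complex.star_def, mul_comm, Complex.mul_conj, Complex.normSq_eq_norm_sq]
    push_cast; rfl
  have h3 : ‖(WithLp.toLp 2 (inputVec F b s) : EuclideanSpace ℂ (Fin dIn))‖ ^ 2 = 1 := by
    exact_mod_cast h2
  exact (pow_eq_one_iff_of_nonneg (norm_nonneg _) two_ne_zero).mp h3

lemma IsFlatUnitary.isPOVM_measVec {F : Matrix (Fin dOut) (Fin dOut) ℂ} (hF : IsFlatUnitary F)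
    (b : Bool) (s : Fin dOut × Bool → Bool) :
    IsPOVM fun j => Matrix.vecMulVec (measVec F b s j) (star (measVec F b s j)) := by
  refine ⟨fun j => Matrix.posSemidef_vecMulVec_self_star _, ?_⟩
  have h1 : ∀ j, Matrix.vecMulVec (measVec F b s j) (star (measVec F b s j)) =
      armBasis F b * Matrix.vecMulVec (fun x => F x j * phaseVec s x)
        (star fun x => F x j * phaseVec s x) * (armBasis F b)ᴴ := by
    intro j
    rw [measVec, Matrix.star_mulVec, Matrix.mul_vecMulVec, Matrix.vecMulVec_mul]
  have h2 : ∑ j, Matrix.vecMulVec (fun x => F x j * phaseVec s x)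
      (star fun x => F x j * phaseVec s x) = 1 := by
    have hFF : F * Fᴴ = 1 := mul_eq_one_comm.mp hF.unitary
    ext x y
    have h3 := congrFun (congrFun hFF x) y
    simp only [Matrix.mul_apply, Matrix.conjTranspose_apply] at h3
    simp only [Matrix.sum_apply, Matrix.vecMulVec_apply, Pi.star_apply, star_mul']
    have e : ∀ j, F x j * phaseVec s x * (star (F y j) * star (phaseVec s y)) =
        phaseVec s x * star (phaseVec s y) * (F x j * star (F y j)) := fun j => by ring
    simp only [e, ← Finset.mul_sum, h3]
    by_cases h : x = y
    · subst h
      rw [Matrix.one_apply_eq, mul_one, mul_comm, star_phaseVec_mul]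
    · rw [Matrix.one_apply_ne h, mul_zero]
  simp only [h1]
  rw [← Finset.sum_mul, ← Finset.mul_sum, h2, Matrix.mul_one,
    mul_eq_one_comm.mp (hF.armBasis_unitary b)]

lemma expect_sum_arrow {κ κ' : Type} [Fintype κ] [DecidableEq κ] [Fintype κ'] [DecidableEq κ']
    (G : (κ → Bool) → (κ' → Bool) → ℝ) :
    𝔼 s : κ ⊕ κ' → Bool, G (s ∘ Sum.inl) (s ∘ Sum.inr) = 𝔼 s, 𝔼 s', G s s' := by
  rw [← Finset.expect_product', Finset.univ_product_univ]
  exact Fintype.expect_equiv (Equiv.sumArrowEquivProdArrow κ κ' Bool) _ _ fun s => rfl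

/-- On average over the random input and the random basis, every outcome sees the squared
Hilbert–Schmidt norm of the Choi matrix, scaled by `1 / (dIn dOut)²`. -/
lemma choiNormSq_le_sum_expect (hIn : 1 ≤ dIn) {F : Matrix (Fin dIn) (Fin dIn) ℂ}
    (hF : IsFlatUnitary F) {F' : Matrix (Fin dOut) (Fin dOut) ℂ} (hF' : IsFlatUnitary F')
    (L : Superoperator dIn dOut) (j : Fin dOut) :
    choiNormSq L / (dIn * dOut : ℝ) ^ 2 ≤
      ∑ b, ∑ b', 𝔼 s : (Fin dIn × Bool) ⊕ (Fin dOut × Bool) → Bool,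
        ‖quadForm (L (Matrix.vecMulVec (inputVec F b (s ∘ Sum.inl))
          (star (inputVec F b (s ∘ Sum.inl))))) (measVec F' b' (s ∘ Sum.inr) j)‖ ^ 2 := by
  have hd0 : (0 : ℝ) < dIn := by exact_mod_cast hIn
  set β : Fin dOut → Fin dOut → Matrix (Fin dIn) (Fin dIn) ℂ := fun x y =>
    Matrix.of fun b a => L (Matrix.single a b 1) x y with hβ
  have hLβ : ∀ (v : Fin dIn → ℂ) x y, L (Matrix.vecMulVec v (star v)) x y = quadForm (β x y) v := by
    intro v x y
    rw [superoperator_apply_eq_sum, quadForm, Finset.sum_comm]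
    refine Finset.sum_congr rfl fun b _ => Finset.sum_congr rfl fun a _ => ?_
    simp only [hβ, Matrix.of_apply, Matrix.vecMulVec_apply, Pi.star_apply]
    ring
  have hchoi : choiNormSq L = ∑ x, ∑ y, hsNormSq (β x y) := by
    have : choiNormSq L = ∑ t : Fin dIn × Fin dIn, ∑ s : Fin dOut × Fin dOut,
        ‖L (Matrix.single t.1 t.2 1) s.1 s.2‖ ^ 2 := by
      simp only [Fintype.sum_prod_type, choiNormSq]
    rw [this, Finset.sum_comm, Fintype.sum_prod_type]
    refine Finset.sum_congr rfl fun x _ => Finset.sum_congr rfl fun y _ => ?_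
    rw [Fintype.sum_prod_type, Finset.sum_comm]
    rfl
  have hin : ∀ x y, (1 / dIn : ℝ) ^ 2 * hsNormSq (β x y) ≤
      ∑ b, 𝔼 s, ‖quadForm (β x y) (inputVec F b s)‖ ^ 2 := by
    intro x y
    refine hF.hsNormSq_le (β x y) (φ := fun _ => ((1 / √dIn : ℝ) : ℂ)) fun _ => ?_
    rw [Complex.star_def, Complex.conj_ofReal, ← Complex.ofReal_mul, div_mul_div_comm,
      Real.mul_self_sqrt hd0.le, one_mul]
  have hout : ∀ γ : Matrix (Fin dOut) (Fin dOut) ℂ, (1 / dOut : ℝ) ^ 2 * hsNormSq γ ≤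
      ∑ b', 𝔼 s, ‖quadForm γ (measVec F' b' s j)‖ ^ 2 := by
    intro γ
    refine hF'.hsNormSq_le γ (φ := fun x => F' x j) fun x => ?_
    rw [hF'.flat]
    push_cast; rfl
  have key : ∀ b, 𝔼 s, (1 / dOut : ℝ) ^ 2 *
      hsNormSq (L (Matrix.vecMulVec (inputVec F b s) (star (inputVec F b s)))) ≤
      ∑ b', 𝔼 s : (Fin dIn × Bool) ⊕ (Fin dOut × Bool) → Bool,
        ‖quadForm (L (Matrix.vecMulVec (inputVec F b (s ∘ Sum.inl))
          (star (inputVec F b (s ∘ Sum.inl))))) (measVec F' b' (s ∘ Sum.inr) j)‖ ^ 2 := by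
    intro b
    have e : ∀ b', 𝔼 s : (Fin dIn × Bool) ⊕ (Fin dOut × Bool) → Bool,
        ‖quadForm (L (Matrix.vecMulVec (inputVec F b (s ∘ Sum.inl))
          (star (inputVec F b (s ∘ Sum.inl))))) (measVec F' b' (s ∘ Sum.inr) j)‖ ^ 2 =
        𝔼 s, 𝔼 s', ‖quadForm (L (Matrix.vecMulVec (inputVec F b s)
          (star (inputVec F b s)))) (measVec F' b' s' j)‖ ^ 2 := fun b' =>
      expect_sum_arrow (fun s s' => ‖quadForm (L (Matrix.vecMulVec (inputVec F b s)
          (star (inputVec F b s)))) (measVec F' b' s' j)‖ ^ 2)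
    simp only [e]
    rw [← Finset.expect_sum_comm]
    exact Finset.expect_le_expect fun s _ => hout _
  refine le_trans ?_ (Finset.sum_le_sum fun b _ => key b)
  simp only [← Finset.mul_expect, ← Finset.mul_sum]
  have e2 : ∑ b, 𝔼 s, hsNormSq (L (Matrix.vecMulVec (inputVec F b s) (star (inputVec F b s)))) =
      ∑ x, ∑ y, ∑ b, 𝔼 s, ‖quadForm (β x y) (inputVec F b s)‖ ^ 2 := by
    simp only [hsNormSq, hLβ, Finset.expect_sum_comm]
    rw [Finset.sum_comm]
    exact Finset.sum_congr rfl fun x _ => Finset.sum_comm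
  rw [e2]
  calc choiNormSq L / (dIn * dOut : ℝ) ^ 2
      = (1 / dOut : ℝ) ^ 2 * ∑ x, ∑ y, (1 / dIn : ℝ) ^ 2 * hsNormSq (β x y) := by
        simp only [← Finset.mul_sum]
        rw [← hchoi]
        rw [mul_pow, div_pow, div_pow, one_pow, ← mul_assoc, div_mul_div_comm, one_mul,
          one_div_mul_eq_div, mul_comm ((dOut : ℝ) ^ 2)]
    _ ≤ _ := by
        gcongr with x _ y _
        exact hin x y

lemma complexLowDeg_phaseVec {ι κ : Type} [Fintype ι] [DecidableEq ι] (i : κ × Bool → ι)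
    (a : κ) : ComplexLowDeg 1 (fun s : ι → Bool => phaseVec (s ∘ i) a) := by
  have h : ∀ s : ι → Bool, phaseVec (s ∘ i) a =
      (((1 / √2 : ℝ) * boolSign (s (i (a, false))) : ℝ) : ℂ) +
        ((1 / √2 : ℝ) * boolSign (s (i (a, true))) : ℝ) * Complex.I := by
    intro s
    simp only [phaseVec, Function.comp]
    push_cast
    ring
  constructor
  · simp only [h, Complex.add_re, Complex.ofReal_re, Complex.re_ofReal_mul, Complex.I_re, mul_zero,
      add_zero]
    exact Submodule.smul_mem _ _ (boolSign_mem_lowDeg _)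
  · simp only [h, Complex.add_im, Complex.ofReal_im, Complex.im_ofReal_mul, Complex.I_im, mul_one,
      zero_add]
    exact Submodule.smul_mem _ _ (boolSign_mem_lowDeg _)

lemma complexLowDeg_mulVec {ι κ : Type} [Fintype ι] [DecidableEq ι] [Fintype κ]
    (i : κ × Bool → ι) (V : Matrix κ κ ℂ) (φ : κ → ℂ) (a : κ) :
    ComplexLowDeg 1 (fun s : ι → Bool => (V *ᵥ fun x => φ x * phaseVec (s ∘ i) x) a) := by
  simp only [Matrix.mulVec, dotProduct]
  exact ComplexLowDeg.sum _ fun x =>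
    ((complexLowDeg_phaseVec i x).const_mul (φ x)).const_mul (V a x)

lemma complexLowDeg_quadForm (F : Matrix (Fin dIn) (Fin dIn) ℂ)
    (F' : Matrix (Fin dOut) (Fin dOut) ℂ) (L : Superoperator dIn dOut) (b b' : Bool)
    (j : Fin dOut) :
    ComplexLowDeg 4 (fun s : (Fin dIn × Bool) ⊕ (Fin dOut × Bool) → Bool =>
      quadForm (L (Matrix.vecMulVec (inputVec F b (s ∘ Sum.inl))
          (star (inputVec F b (s ∘ Sum.inl))))) (measVec F' b' (s ∘ Sum.inr) j)) := by
  simp only [quadForm, superoperator_apply_eq_sum L (Matrix.vecMulVec _ _),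
    Matrix.vecMulVec_apply, Pi.star_apply]
  have hv := fun a => complexLowDeg_mulVec (ι := (Fin dIn × Bool) ⊕ (Fin dOut × Bool)) Sum.inl
    (armBasis F b) (fun _ => ((1 / √dIn : ℝ) : ℂ)) a
  have hw := fun x => complexLowDeg_mulVec (ι := (Fin dIn × Bool) ⊕ (Fin dOut × Bool)) Sum.inr
    (armBasis F' b') (fun x => F' x j) x
  refine ComplexLowDeg.sum _ fun x => ComplexLowDeg.sum _ fun y => ?_
  refine ComplexLowDeg.mul (k := 3) (l := 1) (ComplexLowDeg.mul (k := 1) (l := 2) (hw x).star ?_)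
    (hw y)
  refine ComplexLowDeg.sum _ fun a => ComplexLowDeg.sum _ fun c => ?_
  exact ComplexLowDeg.mul (k := 2) (l := 0)
    (ComplexLowDeg.mul (k := 1) (l := 1) (hv a) (hv c).star) (ComplexLowDeg.const 0 _)

/-- A random setting of one query: the two bases and the signs of all phases. -/
abbrev Setting (dIn dOut : ℕ) : Type :=
  (Bool × Bool) × ((Fin dIn × Bool) ⊕ (Fin dOut × Bool) → Bool)

/-- The input state of a setting. -/
noncomputable def Setting.input (F : Matrix (Fin dIn) (Fin dIn) ℂ) (t : Setting dIn dOut) :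
    Matrix (Fin dIn) (Fin dIn) ℂ :=
  Matrix.vecMulVec (inputVec F t.1.1 (t.2 ∘ Sum.inl)) (star (inputVec F t.1.1 (t.2 ∘ Sum.inl)))

/-- The measurement of a setting. -/
noncomputable def Setting.povm (F' : Matrix (Fin dOut) (Fin dOut) ℂ) (t : Setting dIn dOut)
    (j : Fin dOut) : Matrix (Fin dOut) (Fin dOut) ℂ :=
  Matrix.vecMulVec (measVec F' t.1.2 (t.2 ∘ Sum.inr) j)
    (star (measVec F' t.1.2 (t.2 ∘ Sum.inr) j))

/-- The outcome distribution of a setting for the channel `M`. -/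
noncomputable def Setting.outcome (F : Matrix (Fin dIn) (Fin dIn) ℂ)
    (F' : Matrix (Fin dOut) (Fin dOut) ℂ) (M : Superoperator dIn dOut) (t : Setting dIn dOut)
    (j : Fin dOut) : ℝ :=
  (t.povm F' j * M (t.input F)).trace.re

variable {F : Matrix (Fin dIn) (Fin dIn) ℂ} {F' : Matrix (Fin dOut) (Fin dOut) ℂ}

lemma Setting.outcome_eq (M : Superoperator dIn dOut) (t : Setting dIn dOut) (j : Fin dOut) :
    t.outcome F F' M j =
      (quadForm (M (t.input F)) (measVec F' t.1.2 (t.2 ∘ Sum.inr) j)).re := by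
  rw [Setting.outcome, Setting.povm, trace_vecMulVec_mul]

lemma quadForm_nonneg {d : ℕ} {β : Matrix (Fin d) (Fin d) ℂ} (hβ : β.PosSemidef)
    (v : Fin d → ℂ) : 0 ≤ quadForm β v := by
  rw [quadForm_eq_dotProduct]
  exact hβ.dotProduct_mulVec_nonneg v

lemma IsChannel.quadForm_nonneg {M : Superoperator dIn dOut} (hM : IsChannel M)
    (t : Setting dIn dOut) (w : Fin dOut → ℂ) : 0 ≤ quadForm (M (t.input F)) w :=
  _root_.quadForm_nonneg (hM.posSemidef (Matrix.posSemidef_vecMulVec_self_star _)) w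

lemma Setting.outcome_nonneg {M : Superoperator dIn dOut} (hM : IsChannel M)
    (t : Setting dIn dOut) (j : Fin dOut) : 0 ≤ t.outcome F F' M j := by
  rw [Setting.outcome_eq]
  exact (Complex.le_def.mp (hM.quadForm_nonneg t _)).1

lemma IsPureState.trace_eq_one {d : ℕ} {ρ : Matrix (Fin d) (Fin d) ℂ} (h : IsPureState ρ) :
    ρ.trace = 1 := by
  obtain ⟨v, hv, rfl⟩ := h
  have h2 := EuclideanSpace.norm_sq_eq v
  rw [hv] at h2
  have h3 : ((1 : ℝ) ^ 2 : ℂ) = ∑ i, ((‖v.ofLp i‖ ^ 2 : ℝ) : ℂ) := by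
    rw [← Complex.ofReal_sum, ← h2]; push_cast; rfl
  simp only [Matrix.trace, Matrix.diag, Matrix.vecMulVec_apply, Pi.star_apply, Complex.star_def,
    Complex.mul_conj, Complex.normSq_eq_norm_sq]
  rw [← h3]; norm_num

lemma Setting.sum_outcome (hIn : 1 ≤ dIn) (hF : IsFlatUnitary F) (hF' : IsFlatUnitary F')
    {M : Superoperator dIn dOut} (hM : IsChannel M) (t : Setting dIn dOut) :
    ∑ j, t.outcome F F' M j = 1 := by
  simp only [Setting.outcome]
  rw [← Complex.re_sum, ← Matrix.trace_sum, ← Finset.sum_mul]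
  have h1 : ∑ j, t.povm F' j = 1 := (hF'.isPOVM_measVec t.1.2 (t.2 ∘ Sum.inr)).sum_eq_one
  have h2 : (t.input F).trace = 1 :=
    (hF.isPureState_inputVec hIn t.1.1 (t.2 ∘ Sum.inl)).trace_eq_one
  rw [h1, Matrix.one_mul, hM.tracePreserving, h2, Complex.one_re]

/-- For a channel `M` far from `N` in diamond norm, a random setting has outcome distributions at
`ℓ¹` distance of the order `ε / (dIn √dOut)` with constant probability. -/
lemma expect_indicator_outcome_far (hIn : 1 ≤ dIn) (hOut : 1 ≤ dOut) (hF : IsFlatUnitary F)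
    (hF' : IsFlatUnitary F') {M N : Superoperator dIn dOut} (hM : IsChannel M)
    (hN : IsChannel N) {ε w : ℝ} (hε : ε ≤ diamondNorm (M - N))
    (hw : w = ε / (1728 * dIn * √dOut)) :
    1 / (4 * 432 ^ 2) ≤ 𝔼 t : Setting dIn dOut,
      if w ≤ ∑ j, |t.outcome F F' M j - t.outcome F F' N j| then (1 : ℝ) else 0 := by
  have hd0 : (0 : ℝ) < dIn := by exact_mod_cast hIn
  have hd1 : (0 : ℝ) < dOut := by exact_mod_cast hOut
  set g : Bool → Bool → Fin dOut → ((Fin dIn × Bool) ⊕ (Fin dOut × Bool) → Bool) → ℂ :=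
    fun b b' j s => quadForm ((M - N) (Matrix.vecMulVec (inputVec F b (s ∘ Sum.inl))
          (star (inputVec F b (s ∘ Sum.inl))))) (measVec F' b' (s ∘ Sum.inr) j) with hg
  have hgsub : ∀ b b' j s, g b b' j s =
      quadForm (M (Setting.input F ((b, b'), s))) (measVec F' b' (s ∘ Sum.inr) j) -
      quadForm (N (Setting.input F ((b, b'), s))) (measVec F' b' (s ∘ Sum.inr) j) := by
    intro b b' j s
    simp only [hg, Setting.input, LinearMap.sub_apply, quadForm, Matrix.sub_apply, mul_sub, sub_mul,
      Finset.sum_sub_distrib]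
  have hre : ∀ b b' j s, (g b b' j s).re =
      Setting.outcome F F' M ((b, b'), s) j - Setting.outcome F F' N ((b, b'), s) j := by
    intro b b' j s
    rw [hgsub, Complex.sub_re, Setting.outcome_eq, Setting.outcome_eq]
  have him : ∀ b b' j s, (g b b' j s).im = 0 := by
    intro b b' j s
    have h1 := (Complex.le_def.mp (hM.quadForm_nonneg (F := F) ((b, b'), s)
      (measVec F' b' (s ∘ Sum.inr) j))).2
    have h2 := (Complex.le_def.mp (hN.quadForm_nonneg (F := F) ((b, b'), s)
      (measVec F' b' (s ∘ Sum.inr) j))).2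
    rw [hgsub, Complex.sub_im, ← h1, ← h2]
    simp
  have hnorm : ∀ b b' j s, ‖g b b' j s‖ ^ 2 = (g b b' j s).re ^ 2 := by
    intro b b' j s
    rw [← Complex.normSq_eq_norm_sq, Complex.normSq_apply, him]
    ring
  have hchoi := fun j => choiNormSq_le_sum_expect hIn hF hF' (M - N) j
  set c := choiNormSq (M - N) with hc
  have hc0 : 0 ≤ c := choiNormSq_nonneg _
  have hεc : ε ≤ √dOut * √c := hε.trans (diamondNorm_le _)
  set S : Bool → Bool → ℝ := fun b b' => ∑ j, √(𝔼 s, (g b b' j s).re ^ 2) with hS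
  have hj : ∀ j, √c / (dIn * dOut) ≤ ∑ t : Bool × Bool, √(𝔼 s, (g t.1 t.2 j s).re ^ 2) := by
    intro j
    have h1 := hchoi j
    have h2 : c / (dIn * dOut : ℝ) ^ 2 ≤ ∑ t : Bool × Bool, 𝔼 s, (g t.1 t.2 j s).re ^ 2 := by
      rw [Fintype.sum_prod_type]
      refine h1.trans (le_of_eq ?_)
      refine Finset.sum_congr rfl fun b _ => Finset.sum_congr rfl fun b' _ => ?_
      refine Finset.expect_congr rfl fun s _ => ?_
      exact hnorm b b' j s
    have h3 : ∀ t : Bool × Bool, 𝔼 s, (g t.1 t.2 j s).re ^ 2 =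
        √(𝔼 s, (g t.1 t.2 j s).re ^ 2) ^ 2 := fun t =>
      (Real.sq_sqrt (Finset.expect_nonneg fun s _ => sq_nonneg _)).symm
    have h4 := Finset.sum_sq_le_sq_sum_of_nonneg (s := Finset.univ)
      (f := fun t : Bool × Bool => √(𝔼 s, (g t.1 t.2 j s).re ^ 2)) fun t _ => Real.sqrt_nonneg _
    refine le_of_sq_le_sq ?_ (Finset.sum_nonneg fun t _ => Real.sqrt_nonneg _)
    rw [div_pow, Real.sq_sqrt hc0]
    refine h2.trans (le_trans (le_of_eq ?_) h4)
    exact Finset.sum_congr rfl fun t _ => h3 t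
  have hStot : 4 * (432 * w) ≤ ∑ t : Bool × Bool, S t.1 t.2 := by
    have h1 : ∑ t : Bool × Bool, S t.1 t.2 =
        ∑ j, ∑ t : Bool × Bool, √(𝔼 s, (g t.1 t.2 j s).re ^ 2) := Finset.sum_comm
    rw [h1]
    have h2 := Finset.sum_le_sum fun j (_ : j ∈ (Finset.univ : Finset (Fin dOut))) => hj j
    rw [Finset.sum_const, Finset.card_univ, Fintype.card_fin, nsmul_eq_mul] at h2
    refine le_trans ?_ h2
    have hs : √(dOut : ℝ) * √dOut = dOut := Real.mul_self_sqrt hd1.le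
    have hs0 : 0 < √(dOut : ℝ) := Real.sqrt_pos.mpr hd1
    have e1 : 4 * (432 * w) = ε / (dIn * √dOut) := by
      rw [hw]; field_simp; ring
    have e2 : (dOut : ℝ) * (√c / (dIn * dOut)) = √c / dIn := by field_simp
    rw [e1, e2, div_le_div_iff₀ (by positivity) hd0]
    have := mul_le_mul_of_nonneg_right hεc hd0.le
    linarith
  obtain ⟨⟨b, b'⟩, -, hbb⟩ : ∃ t ∈ (Finset.univ : Finset (Bool × Bool)), 432 * w ≤ S t.1 t.2 := by
    refine Finset.exists_le_of_sum_le ⟨(true, true), Finset.mem_univ _⟩ ?_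
    refine le_trans (le_of_eq ?_) hStot
    simp
  have hpz := expect_indicator_sum_abs_ge
    (fun j => (complexLowDeg_quadForm F F' (M - N) b b' j).1) hbb
  have hsingle : ∀ t : Bool × Bool, 0 ≤ 𝔼 s,
      if w ≤ ∑ j, |Setting.outcome F F' M (t, s) j - Setting.outcome F F' N (t, s) j|
        then (1 : ℝ) else 0 :=
    fun t => Finset.expect_nonneg fun s _ => by split_ifs <;> norm_num
  rw [← Finset.univ_product_univ, Finset.expect_product]
  have h5 := Finset.single_le_sum (fun t _ => hsingle t) (Finset.mem_univ (b, b'))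
  rw [Fintype.expect_eq_sum_div_card]
  simp only [Fintype.card_prod, Fintype.card_bool]
  have h6 : (1 : ℝ) / 432 ^ 2 ≤ 𝔼 s,
      if w ≤ ∑ j, |Setting.outcome F F' M ((b, b'), s) j -
        Setting.outcome F F' N ((b, b'), s) j| then (1 : ℝ) else 0 := by
    simpa only [← hre] using hpz
  rw [le_div_iff₀ (by norm_num)]
  refine le_trans ?_ (h6.trans h5)
  norm_num

end Settings

/-! ### The channel tester -/

section Tester

variable {dIn dOut : ℕ}

/-- The probability that the classical identity test for the outcome distribution of `N`, run with
`2m` queries to `M` in the setting `t`, stays below the threshold `θ`. -/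
noncomputable def settingAccept (F : Matrix (Fin dIn) (Fin dIn) ℂ)
    (F' : Matrix (Fin dOut) (Fin dOut) ℂ) (M N : Superoperator dIn dOut) (m : ℕ) (θ : ℝ)
    (t : Setting dIn dOut) : ℝ :=
  iidExp (t.outcome F F' M) (fun z : Fin m ⊕ Fin m → Fin dOut =>
    if crossStat (t.outcome F F' N) z < θ then 1 else 0)

/-- The queries: `K` rounds of two batches of `m` queries. -/
noncomputable def queryEquiv (K m : ℕ) : Fin (K * (m + m)) ≃ Fin K × (Fin m ⊕ Fin m) :=
  finProdFinEquiv.symm.trans (Equiv.prodCongr (Equiv.refl _) finSumFinEquiv.symm)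

/-- The deterministic tester for given settings of the `K` rounds: it accepts if the identity test
of every round does. -/
noncomputable def roundsTester (hIn : 1 ≤ dIn) {F : Matrix (Fin dIn) (Fin dIn) ℂ}
    {F' : Matrix (Fin dOut) (Fin dOut) ℂ} (hF : IsFlatUnitary F) (hF' : IsFlatUnitary F')
    (N : Superoperator dIn dOut) (K m : ℕ) (θ : ℝ) (ω : Fin K → Setting dIn dOut) :
    DeterministicTester dIn dOut (K * (m + m)) where
  input i := (ω (queryEquiv K m i).1).input F
  input_pure i := hF.isPureState_inputVec hIn _ _
  numOutcomes _ := dOut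
  povm i := (ω (queryEquiv K m i).1).povm F'
  povm_isPOVM i := hF'.isPOVM_measVec _ _
  decision x := by
    classical
    exact decide (∀ k, crossStat ((ω k).outcome F F' N)
      (fun z => x ((queryEquiv K m).symm (k, z))) < θ)

variable {F : Matrix (Fin dIn) (Fin dIn) ℂ} {F' : Matrix (Fin dOut) (Fin dOut) ℂ}

lemma outputProb_roundsTester_true (hIn : 1 ≤ dIn) (hF : IsFlatUnitary F) (hF' : IsFlatUnitary F')
    (M N : Superoperator dIn dOut) (K m : ℕ) (θ : ℝ) (ω : Fin K → Setting dIn dOut) :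
    (roundsTester hIn hF hF' N K m θ ω).outputProb M true =
      ∏ k, settingAccept F F' M N m θ (ω k) := by
  classical
  set e := queryEquiv K m with he
  have h1 : (roundsTester hIn hF hF' N K m θ ω).outputProb M true =
      ∑ x : Fin (K * (m + m)) → Fin dOut,
        if (∀ k, crossStat ((ω k).outcome F F' N) (fun z => x (e.symm (k, z))) < θ) then
          ∏ i, (ω (e i).1).outcome F F' M (x i) else 0 := by
    rw [DeterministicTester.outputProb, Finset.sum_filter]
    refine Finset.sum_congr rfl fun x _ => ?_
    simp only [roundsTester, decide_eq_true_eq]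
    rfl
  have h2 : ∀ k, settingAccept F F' M N m θ (ω k) =
      ∑ y : Fin m ⊕ Fin m → Fin dOut, (∏ z, (ω k).outcome F F' M (y z)) *
        if crossStat ((ω k).outcome F F' N) y < θ then 1 else 0 := fun k => rfl
  rw [h1, Finset.prod_congr rfl fun k _ => h2 k, Fintype.prod_sum]
  refine Fintype.sum_equiv ((Equiv.arrowCongr e (Equiv.refl (Fin dOut))).trans
    (Equiv.curry (Fin K) (Fin m ⊕ Fin m) (Fin dOut))) _ _ fun x => ?_
  rw [Finset.prod_mul_distrib]
  have h3 : ∏ i, (ω (e i).1).outcome F F' M (x i) =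
      ∏ k, ∏ z, (ω k).outcome F F' M (x (e.symm (k, z))) := by
    rw [← Equiv.prod_comp e.symm, Fintype.prod_prod_type]
    simp
  have h4 : ∀ k, ((Equiv.arrowCongr e (Equiv.refl (Fin dOut))).trans
    (Equiv.curry (Fin K) (Fin m ⊕ Fin m) (Fin dOut))) x k = fun z => x (e.symm (k, z)) :=
    fun k => rfl
  simp only [h4, h3]
  rw [Finset.prod_ite_zero]
  simp

lemma outputProb_roundsTester_false (hIn : 1 ≤ dIn) (hF : IsFlatUnitary F)
    (hF' : IsFlatUnitary F') {M : Superoperator dIn dOut} (hM : IsChannel M)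
    (N : Superoperator dIn dOut) (K m : ℕ) (θ : ℝ) (ω : Fin K → Setting dIn dOut) :
    (roundsTester hIn hF hF' N K m θ ω).outputProb M false =
      1 - (roundsTester hIn hF hF' N K m θ ω).outputProb M true := by
  set T := roundsTester hIn hF hF' N K m θ ω with hT
  have hsum : ∑ x : ∀ j, Fin (T.numOutcomes j), ∏ j, (T.povm j (x j) * M (T.input j)).trace.re = 1 := by
    rw [← Fintype.prod_sum (fun j i => (T.povm j i * M (T.input j)).trace.re)]
    refine Finset.prod_eq_one fun j _ => ?_
    exact Setting.sum_outcome hIn hF hF' hM (ω (queryEquiv K m j).1)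
  have h : T.outputProb M true + T.outputProb M false = 1 := by
    rw [← hsum, DeterministicTester.outputProb, DeterministicTester.outputProb,
      ← Finset.sum_filter_add_sum_filter_not Finset.univ (fun x => T.decision x = true)]
    simp only [Bool.not_eq_true]
  linarith

/-- The randomized tester: `K` independent uniformly random settings. -/
noncomputable def randomTester (hIn : 1 ≤ dIn) (hF : IsFlatUnitary F) (hF' : IsFlatUnitary F')
    (N : Superoperator dIn dOut) (K m : ℕ) (θ : ℝ) : ChannelTester dIn dOut (K * (m + m)) where
  Ω := Fin K → Setting dIn dOut
  measurableSpace := ⊤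
  μ := @PMF.toMeasure _ ⊤ (PMF.uniformOfFintype (Fin K → Setting dIn dOut))
  isProbabilityMeasure := @PMF.toMeasure.isProbabilityMeasure _ ⊤ _
  tester := roundsTester hIn hF hF' N K m θ
  measurable_outputProb _ _ _ := measurable_from_top

lemma outputProb_randomTester (hIn : 1 ≤ dIn) (hF : IsFlatUnitary F) (hF' : IsFlatUnitary F')
    (M N : Superoperator dIn dOut) (K m : ℕ) (θ : ℝ) (b : Bool) :
    (randomTester hIn hF hF' N K m θ).outputProb M b =
      𝔼 ω, (roundsTester hIn hF hF' N K m θ ω).outputProb M b := by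
  let _ : MeasurableSpace (Fin K → Setting dIn dOut) := ⊤
  have h := PMF.integral_eq_sum (PMF.uniformOfFintype (Fin K → Setting dIn dOut))
    (fun ω => (roundsTester hIn hF hF' N K m θ ω).outputProb M b)
  refine Eq.trans h ?_
  rw [Fintype.expect_eq_sum_div_card, Finset.sum_div]
  refine Finset.sum_congr rfl fun ω _ => ?_
  rw [PMF.uniformOfFintype_apply, ENNReal.toReal_inv, ENNReal.toReal_natCast, smul_eq_mul,
    div_eq_inv_mul]

lemma acceptProb_randomTester (hIn : 1 ≤ dIn) (hF : IsFlatUnitary F) (hF' : IsFlatUnitary F')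
    (M N : Superoperator dIn dOut) (K m : ℕ) (θ : ℝ) :
    (randomTester hIn hF hF' N K m θ).acceptProb M =
      (𝔼 t, settingAccept F F' M N m θ t) ^ K := by
  rw [ChannelTester.acceptProb, outputProb_randomTester, Finset.expect_pow, Fintype.piFinset_univ]
  exact Finset.expect_congr rfl fun ω _ => outputProb_roundsTester_true hIn hF hF' M N K m θ ω

lemma rejectProb_randomTester (hIn : 1 ≤ dIn) (hF : IsFlatUnitary F) (hF' : IsFlatUnitary F')
    {M : Superoperator dIn dOut} (hM : IsChannel M) (N : Superoperator dIn dOut) (K m : ℕ)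
    (θ : ℝ) :
    (randomTester hIn hF hF' N K m θ).rejectProb M =
      1 - (𝔼 t, settingAccept F F' M N m θ t) ^ K := by
  rw [← acceptProb_randomTester hIn hF hF', ChannelTester.rejectProb, ChannelTester.acceptProb,
    outputProb_randomTester, outputProb_randomTester]
  simp only [outputProb_roundsTester_false hIn hF hF' hM, Finset.expect_sub_distrib,
    Fintype.expect_const]

lemma settingAccept_nonneg {M : Superoperator dIn dOut} (hM : IsChannel M)
    (N : Superoperator dIn dOut) (m : ℕ) (θ : ℝ) (t : Setting dIn dOut) :
    0 ≤ settingAccept F F' M N m θ t :=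
  Finset.sum_nonneg fun x _ => mul_nonneg
    (Finset.prod_nonneg fun s _ => Setting.outcome_nonneg hM t (x s))
    (by dsimp only; split_ifs <;> norm_num)

lemma settingAccept_le_one (hIn : 1 ≤ dIn) (hF : IsFlatUnitary F) (hF' : IsFlatUnitary F')
    {M : Superoperator dIn dOut} (hM : IsChannel M) (N : Superoperator dIn dOut) (m : ℕ) (θ : ℝ)
    (t : Setting dIn dOut) : settingAccept F F' M N m θ t ≤ 1 := by
  rw [← iidExp_const (σ := Fin m ⊕ Fin m) (Setting.sum_outcome hIn hF hF' hM t) 1]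
  exact iidExp_mono (Setting.outcome_nonneg hM t) fun z => by split_ifs <;> norm_num

lemma settingAccept_null (hIn : 1 ≤ dIn) (hF : IsFlatUnitary F) (hF' : IsFlatUnitary F')
    {N : Superoperator dIn dOut} (hN : IsChannel N) (m : ℕ) {θ : ℝ} (hθ : 0 < θ)
    (t : Setting dIn dOut) :
    1 - 2 * (m : ℝ) ^ 2 / (dOut * θ ^ 2) ≤ settingAccept F F' N N m θ t := by
  have hq0 := Setting.outcome_nonneg (F := F) (F' := F') hN t
  have hq1 := Setting.sum_outcome hIn hF hF' hN t
  have h := iidExp_le_crossStat_null (σ := Fin m) hq0 hq1 hθ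
  rw [Fintype.card_fin, Fintype.card_fin] at h
  have h2 := iidExp_add (σ := Fin m ⊕ Fin m) (t.outcome F F' N)
    (fun z => if crossStat (t.outcome F F' N) z < θ then 0 else 1)
    (fun z => if crossStat (t.outcome F F' N) z < θ then 1 else 0)
  have e : ∀ z : Fin m ⊕ Fin m → Fin dOut,
      (if crossStat (t.outcome F F' N) z < θ then (0 : ℝ) else 1) +
        (if crossStat (t.outcome F F' N) z < θ then 1 else 0) = 1 := fun z => by
    split_ifs <;> norm_num
  simp only [e, iidExp_const hq1] at h2
  rw [settingAccept]
  linarith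

lemma settingAccept_far (hIn : 1 ≤ dIn) (hOut : 1 ≤ dOut) (hF : IsFlatUnitary F)
    (hF' : IsFlatUnitary F') {M N : Superoperator dIn dOut} (hM : IsChannel M) (hN : IsChannel N)
    {m : ℕ} {w τ : ℝ} (hw : 0 < w) (hτ : τ = w ^ 2 / (2 * dOut))
    (h1 : 40 ≤ m * √dOut * τ) (h2 : 40 ≤ m * √τ) {t : Setting dIn dOut}
    (ht : w ≤ ∑ j, |t.outcome F F' M j - t.outcome F F' N j|) :
    settingAccept F F' M N m ((m : ℝ) ^ 2 * τ / 2) t ≤ 1 / 2 := by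
  have hd : (0 : ℝ) < dOut := by exact_mod_cast hOut
  have hq0 := Setting.outcome_nonneg (F := F) (F' := F') hN t
  have hq1 := Setting.sum_outcome hIn hF hF' hN t
  have hτ0 : 0 < τ := by rw [hτ]; positivity
  have hZ : τ ≤ dampDist (t.outcome F F' M) (t.outcome F F' N) := by
    have h := sq_sum_abs_le_dampDist (p := t.outcome F F' M) hq0 hq1
    rw [Fintype.card_fin] at h
    rw [hτ, div_le_iff₀ (by positivity)]
    have := pow_le_pow_left₀ hw.le ht 2
    linarith
  have h := iidExp_crossStat_far (σ := Fin m) (Setting.outcome_nonneg (F := F) (F' := F') hM t)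
    (Setting.sum_outcome hIn hF hF' hM t) hq0 hq1 hτ0 hZ
    (by simpa using h1) (by simpa using h2)
  rw [Fintype.card_fin] at h
  exact h

lemma expect_settingAccept_far (hIn : 1 ≤ dIn) (hOut : 1 ≤ dOut) (hF : IsFlatUnitary F)
    (hF' : IsFlatUnitary F') {M N : Superoperator dIn dOut} (hM : IsChannel M) (hN : IsChannel N)
    {m : ℕ} {ε w τ : ℝ} (hε : ε ≤ diamondNorm (M - N)) (hw : w = ε / (1728 * dIn * √dOut))
    (hw0 : 0 < w) (hτ : τ = w ^ 2 / (2 * dOut)) (h1 : 40 ≤ m * √dOut * τ) (h2 : 40 ≤ m * √τ) :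
    𝔼 t, settingAccept F F' M N m ((m : ℝ) ^ 2 * τ / 2) t ≤ 1 - 1 / (8 * 432 ^ 2) := by
  have h := expect_indicator_outcome_far hIn hOut hF hF' hM hN hε hw
  have h3 : 𝔼 t, settingAccept F F' M N m ((m : ℝ) ^ 2 * τ / 2) t ≤
      𝔼 t : Setting dIn dOut, (1 - 1 / 2 * if w ≤ ∑ j, |t.outcome F F' M j - t.outcome F F' N j|
        then (1 : ℝ) else 0) := by
    refine Finset.expect_le_expect fun t _ => ?_
    split_ifs with ht
    · have := settingAccept_far hIn hOut hF hF' hM hN hw0 hτ h1 h2 ht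
      linarith
    · have := settingAccept_le_one hIn hF hF' hM N m ((m : ℝ) ^ 2 * τ / 2) t
      linarith
  rw [Finset.expect_sub_distrib, Fintype.expect_const, ← Finset.mul_expect] at h3
  linarith

/-- Outcome distributions are at `ℓ¹` distance at most `2`, so that a far channel exists only if
the distance that the settings reveal is at most `2`. -/
lemma le_two_of_le_diamondNorm (hIn : 1 ≤ dIn) (hOut : 1 ≤ dOut) (hF : IsFlatUnitary F)
    (hF' : IsFlatUnitary F') {M N : Superoperator dIn dOut} (hM : IsChannel M) (hN : IsChannel N)
    {ε w : ℝ} (hε : ε ≤ diamondNorm (M - N)) (hw : w = ε / (1728 * dIn * √dOut)) : w ≤ 2 := by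
  have h := expect_indicator_outcome_far hIn hOut hF hF' hM hN hε hw
  have h0 : 𝔼 t : Setting dIn dOut, (if w ≤ ∑ j, |t.outcome F F' M j - t.outcome F F' N j|
      then (1 : ℝ) else 0) ≠ 0 := by
    intro hz
    rw [hz] at h
    norm_num at h
  obtain ⟨t, -, ht⟩ := Finset.exists_ne_zero_of_expect_ne_zero h0
  have hwt : w ≤ ∑ j, |t.outcome F F' M j - t.outcome F F' N j| := by
    by_contra hc
    exact ht (if_neg hc)
  refine hwt.trans ?_
  calc ∑ j, |t.outcome F F' M j - t.outcome F F' N j|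
      ≤ ∑ j, (t.outcome F F' M j + t.outcome F F' N j) := by
        refine Finset.sum_le_sum fun j _ => ?_
        have h1 := Setting.outcome_nonneg (F := F) (F' := F') hM t j
        have h2 := Setting.outcome_nonneg (F := F) (F' := F') hN t j
        rw [abs_le]
        constructor <;> linarith
    _ = 2 := by
        rw [Finset.sum_add_distrib, Setting.sum_outcome hIn hF hF' hM,
          Setting.sum_outcome hIn hF hF' hN]
        norm_num

/-- The tester that makes no query and accepts. -/
noncomputable def alwaysAccept (dIn dOut : ℕ) : ChannelTester dIn dOut 0 where
  Ω := Unit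
  measurableSpace := ⊤
  μ := @MeasureTheory.Measure.dirac _ ⊤ ()
  isProbabilityMeasure := @MeasureTheory.Measure.dirac.isProbabilityMeasure _ ⊤ _
  tester _ :=
    { input := Fin.elim0
      input_pure := fun j => j.elim0
      numOutcomes := Fin.elim0
      povm := fun j => j.elim0
      povm_isPOVM := fun j => j.elim0
      decision := fun _ => true }
  measurable_outputProb _ _ _ := measurable_from_top

lemma acceptProb_alwaysAccept (M : Superoperator dIn dOut) :
    (alwaysAccept dIn dOut).acceptProb M = 1 := by
  let _ : MeasurableSpace Unit := ⊤
  have h : ∀ ω, ((alwaysAccept dIn dOut).tester ω).outputProb M true = 1 := by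
    intro ω
    rw [DeterministicTester.outputProb]
    have : ∀ x, ((alwaysAccept dIn dOut).tester ω).decision x = true := fun x => rfl
    simp only [this, Finset.filter_true, Finset.univ_eq_empty, Finset.prod_empty,
      Finset.sum_const, nsmul_eq_mul, mul_one]
    have hc : Fintype.card (∀ j, Fin (((alwaysAccept dIn dOut).tester ω).numOutcomes j)) = 1 := by
      rw [Fintype.card_pi]; simp
    rw [Finset.card_univ, hc, Nat.cast_one]
  rw [ChannelTester.acceptProb, ChannelTester.outputProb]
  simp only [h]
  have := (alwaysAccept dIn dOut).isProbabilityMeasure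
  simp

/-- With `m` of the order of `√dOut / w²`, the randomized tester works. -/
lemma testsIdentity_randomTester (hIn : 1 ≤ dIn) (hOut : 1 ≤ dOut) (hF : IsFlatUnitary F)
    (hF' : IsFlatUnitary F') {N : Superoperator dIn dOut} (hN : IsChannel N) {K m : ℕ}
    (hK : 1 ≤ K) (hKpow : (1 - 1 / (8 * 432 ^ 2) : ℝ) ^ K ≤ 1 / 3) {ε w τ : ℝ}
    (hw : w = ε / (1728 * dIn * √dOut)) (hw0 : 0 < w) (hw2 : w ≤ 2)
    (hτ : τ = w ^ 2 / (2 * dOut)) (hm : 200 * K * √dOut / w ^ 2 ≤ m) :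
    (randomTester hIn hF hF' N K m ((m : ℝ) ^ 2 * τ / 2)).TestsIdentity N ε := by
  have hd : (1 : ℝ) ≤ dOut := by exact_mod_cast hOut
  have hd0 : (0 : ℝ) < dOut := by linarith
  have hK1 : (1 : ℝ) ≤ K := by exact_mod_cast hK
  have hs : √(dOut : ℝ) ^ 2 = dOut := Real.sq_sqrt hd0.le
  have hs0 : 0 < √(dOut : ℝ) := Real.sqrt_pos.mpr hd0
  have hτ0 : 0 < τ := by rw [hτ]; positivity
  have hm0 : (0 : ℝ) < m := lt_of_lt_of_le (by positivity) hm
  have h1 : 100 * K ≤ m * √dOut * τ := by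
    calc (100 * K : ℝ) = 200 * K * √dOut / w ^ 2 * √dOut * τ := by
          rw [hτ]; field_simp; rw [hs]; ring
      _ ≤ m * √dOut * τ := by gcongr
  have h2 : 40 ≤ m * √τ := by
    have hsq : (40 : ℝ) ^ 2 ≤ (m * √τ) ^ 2 := by
      rw [mul_pow, Real.sq_sqrt hτ0.le]
      have e : (200 * K * √dOut / w ^ 2) ^ 2 * τ = 20000 * K ^ 2 / w ^ 2 := by
        rw [hτ]; field_simp; rw [hs]; ring
      have h3 : (200 * K * √dOut / w ^ 2) ^ 2 * τ ≤ (m : ℝ) ^ 2 * τ := by gcongr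
      rw [e] at h3
      refine le_trans ?_ h3
      rw [le_div_iff₀ (by positivity)]
      have : w ^ 2 ≤ 4 := by nlinarith
      nlinarith
    exact le_of_sq_le_sq hsq (by positivity)
  intro M hM
  constructor
  · rintro rfl
    rw [acceptProb_randomTester]
    have hθ : 0 < (m : ℝ) ^ 2 * τ / 2 := by positivity
    have herr : 2 * (m : ℝ) ^ 2 / (dOut * ((m : ℝ) ^ 2 * τ / 2) ^ 2) ≤ 1 / (3 * K) := by
      have e : 2 * (m : ℝ) ^ 2 / (dOut * ((m : ℝ) ^ 2 * τ / 2) ^ 2) = 8 / (m * √dOut * τ) ^ 2 := by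
        rw [mul_pow, mul_pow, hs]; field_simp; norm_num
      rw [e, div_le_div_iff₀ (by positivity) (by positivity)]
      have := pow_le_pow_left₀ (by positivity) h1 2
      nlinarith
    have hE : 1 - 1 / (3 * (K : ℝ)) ≤ 𝔼 t, settingAccept F F' M M m ((m : ℝ) ^ 2 * τ / 2) t := by
      rw [← Fintype.expect_const (ι := Setting dIn dOut) (1 - 1 / (3 * (K : ℝ)))]
      refine Finset.expect_le_expect fun t _ => ?_
      have := settingAccept_null hIn hF hF' hM m hθ t
      linarith
    have hle : 1 / (3 * (K : ℝ)) ≤ 1 := by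
      rw [div_le_one (by positivity)]; linarith
    have hb := one_add_mul_le_pow (a := -(1 / (3 * (K : ℝ)))) (by linarith) K
    have e3 : 1 + (K : ℝ) * -(1 / (3 * (K : ℝ))) = 2 / 3 := by field_simp; norm_num
    rw [e3] at hb
    exact hb.trans (pow_le_pow_left₀ (by linarith) (by linarith) K)
  · intro hε
    rw [rejectProb_randomTester hIn hF hF' hM]
    have hE := expect_settingAccept_far hIn hOut hF hF' hM hN hε hw hw0 hτ
      (by linarith : (40 : ℝ) ≤ m * √dOut * τ) h2
    have h0 : 0 ≤ 𝔼 t, settingAccept F F' M N m ((m : ℝ) ^ 2 * τ / 2) t :=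
      Finset.expect_nonneg fun t _ => settingAccept_nonneg hM N m _ t
    have := pow_le_pow_left₀ h0 hE K
    linarith

end Tester

theorem theorem1p8 :
    ∃ C : ℝ, 0 < C ∧ ∃ k : ℕ,
      ∀ (dIn dOut : ℕ), 1 ≤ dIn → 1 ≤ dOut →
      ∀ N : Superoperator dIn dOut, IsChannel N →
      ∀ ε : ℝ, 0 < ε →
      ∃ n : ℕ,
        (n : ℝ) ≤ C * ((dIn : ℝ) ^ 2 * (dOut : ℝ) ^ (3 / 2 : ℝ) / ε ^ 2)
            * Real.logb 2 (2 + (dIn : ℝ) ^ 2 * (dOut : ℝ) ^ (3 / 2 : ℝ) / ε ^ 2) ^ k ∧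
        ∃ T : ChannelTester dIn dOut n, T.TestsIdentity N ε := by
  obtain ⟨K, hKpow⟩ := exists_pow_lt_of_lt_one (show (0 : ℝ) < 1 / 3 by norm_num)
    (show (1 - 1 / (8 * 432 ^ 2) : ℝ) < 1 by norm_num)
  have hK : 1 ≤ K := by
    rcases Nat.eq_zero_or_pos K with rfl | h
    · norm_num at hKpow
    · exact h
  have hK1 : (1 : ℝ) ≤ K := by exact_mod_cast hK
  refine ⟨2 * K * (200 * K + 4) * 1728 ^ 2, by positivity, 0, ?_⟩
  intro dIn dOut hIn hOut N hN ε hε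
  have hd : (1 : ℝ) ≤ dOut := by exact_mod_cast hOut
  have hd0 : (0 : ℝ) < dOut := by linarith
  have hi0 : (0 : ℝ) < dIn := by exact_mod_cast hIn
  have hs : √(dOut : ℝ) ^ 2 = dOut := Real.sq_sqrt hd0.le
  have hs1 : 1 ≤ √(dOut : ℝ) := by rw [← Real.sqrt_one]; exact Real.sqrt_le_sqrt hd
  by_cases hfar : ∃ M : Superoperator dIn dOut, IsChannel M ∧ ε ≤ diamondNorm (M - N)
  · obtain ⟨M, hM, hMN⟩ := hfar
    obtain ⟨F, hF⟩ := exists_isFlatUnitary hIn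
    obtain ⟨F', hF'⟩ := exists_isFlatUnitary hOut
    obtain ⟨w, hw⟩ : ∃ w, w = ε / (1728 * dIn * √dOut) := ⟨_, rfl⟩
    have hw0 : 0 < w := by rw [hw]; positivity
    have hw2 := le_two_of_le_diamondNorm hIn hOut hF hF' hM hN hMN hw
    set m := ⌈200 * K * √dOut / w ^ 2⌉₊ with hm
    refine ⟨K * (m + m), ?_, _, testsIdentity_randomTester hIn hOut hF hF' hN hK hKpow.le hw hw0
      hw2 rfl (Nat.le_ceil _)⟩
    have hmle : (m : ℝ) ≤ 200 * K * √dOut / w ^ 2 + 1 :=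
      (Nat.ceil_lt_add_one (by positivity)).le
    -- The rounding is absorbed because `√dOut / w² ≥ 1/4`.
    have hone : 1 ≤ 4 * √dOut / w ^ 2 := by
      rw [le_div_iff₀ (by positivity)]
      nlinarith
    have hpow : (dOut : ℝ) ^ (3 / 2 : ℝ) = dOut * √dOut := by
      rw [Real.sqrt_eq_rpow, show (3 / 2 : ℝ) = 1 + 1 / 2 by norm_num, Real.rpow_add hd0,
        Real.rpow_one]
    have hq : √dOut / w ^ 2 = 1728 ^ 2 * ((dIn : ℝ) ^ 2 * (dOut : ℝ) ^ (3 / 2 : ℝ) / ε ^ 2) := by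
      rw [hpow, hw, ← hs]
      field_simp
      rw [hs, hs]
    rw [pow_zero, mul_one]
    push_cast
    calc (K : ℝ) * (m + m) ≤ 2 * K * (200 * K * √dOut / w ^ 2 + 4 * √dOut / w ^ 2) := by
          nlinarith
      _ = 2 * K * (200 * K + 4) * (√dOut / w ^ 2) := by ring
      _ = _ := by rw [hq]; ring
  · refine ⟨0, ?_, alwaysAccept dIn dOut, fun M hM => ⟨fun _ => ?_, fun h => ?_⟩⟩
    · simp only [Nat.cast_zero, pow_zero, mul_one]
      positivity
    · rw [acceptProb_alwaysAccept]; norm_num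
    · exact absurd ⟨M, hM, h⟩ hfar
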